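/- Let $E$ and $F$ be Archimedean (real) vector lattices carrying locally convex-solid topologies (linear topologies with a base at $0$ of convex solid sets; not assumed Hausdorff), generated by families $(p_\alpha)_{\alpha\in I}$ and $(q_\beta)_{\beta\in J}$ of Riesz seminorms, respectively, i.e. seminorms $p$ such that $|x|\le|y|$ implies $p(x)\le p(y)$. Let $E\overline{\otimes}F$ be the Fremlin tensor product, i.e. the Archimedean vector lattice with a lattice bimorphism $\otimes:E\times F\to E\overline{\otimes}F$ such that every lattice bimorphism from $E\times F$ into an Archimedean vector lattice $G$ factors through $\otimes$ by a unique lattice homomorphism $E\overline{\otimes}F\to G$. For $\alpha\in I$ and $\beta\in J$ put $U_\alpha=\{x\in E:p_\alpha(x)\le 1\}$, $V_\beta=\{y\in F:q_\beta(y)\le 1\}$, and let $W_{\alpha,\beta}$ be the convex balanced hull of the solid hull of $\{x\otimes y:x\in U_\alpha,\ y\in V_\beta\}$ in $E\overline{\otimes}F$; here the solid hull of a set $A$ is $\{u:\exists v\in A,\ |u|\le|v|\}$. Let $p_\alpha\otimes q_\beta$ be the seminorm \[(p_\alpha\otimes q_\beta)(u)=\inf\{r>0:u\in rW_{\alpha,\beta}\}\qquad(u\in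 E\overline{\otimes}F).\] Then for all $\alpha\in I$, $\beta\in J$, $x_0\in E$ and $y_0\in F$, \[(p_\alpha\otimes q_\beta)(x_0\otimes y_0)=p_\alpha(x_0)\,q_\beta(y_0).\] -/

import Mathlib

open scoped Topology Pointwise

/-! ### Archimedean vector lattices and lattice bimorphisms

A (real) vector lattice is a type `E` with
`[AddCommGroup E] [Lattice E] [IsOrderedAddMonoid E] [Module ℝ E] [IsOrderedModule ℝ E]`. -/

/-- A vector lattice is Archimedean if `n x ≤ y` for all `n` forces `x ≤ 0`. (Mathlib's `Archimedean`
is a different notion, suited to linear orders only.) -/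
class ArchimedeanVectorLattice (E : Type*) [AddCommGroup E] [Lattice E] : Prop where
  le_zero_of_forall_nsmul_le : ∀ x y : E, (∀ n : ℕ, n • x ≤ y) → x ≤ 0

/-- A bilinear map `Φ : E × F → G` of vector lattices is a lattice bimorphism if `Φ(x, ·)` and
`Φ(·, y)` are lattice homomorphisms for all `x, y ≥ 0`. (For a linear map, preserving `⊔` is enough
to be a lattice homomorphism.) -/
structure IsLatticeBimorphism {E F G : Type*}
    [AddCommGroup E] [Lattice E] [Module ℝ E] [AddCommGroup F] [Lattice F] [Module ℝ F]
    [AddCommGroup G] [Lattice G] [Module ℝ G] (Φ : E →ₗ[ℝ] F →ₗ[ℝ] G) : Prop where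
  map_sup_right : ∀ (x : E) (y y' : F), 0 ≤ x → Φ x (y ⊔ y') = Φ x y ⊔ Φ x y'
  map_sup_left : ∀ (x x' : E) (y : F), 0 ≤ y → Φ (x ⊔ x') y = Φ x y ⊔ Φ x' y

/-! ### The Fremlin tensor product

It is built by generators and relations, as the Archimedean vector lattice freely generated by the
symbols `x ⊗ y` subject to the relations that make `(x, y) ↦ x ⊗ y` a lattice bimorphism. Its
universal property is `FremlinTensor.existsUnique_lift` below. -/

/-- Formal vector-lattice expressions in the symbols `x ⊗ y`. -/
inductive FremlinTerm (E F : Type*) where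
  | tmul : E → F → FremlinTerm E F
  | zero : FremlinTerm E F
  | add : FremlinTerm E F → FremlinTerm E F → FremlinTerm E F
  | smul : ℝ → FremlinTerm E F → FremlinTerm E F
  | sup : FremlinTerm E F → FremlinTerm E F → FremlinTerm E F

open FremlinTerm in
/-- The smallest congruence on expressions that contains the axioms of a vector lattice, the
Archimedean axiom and the relations of a lattice bimorphism. -/
inductive FremlinRel (E F : Type*) [AddCommGroup E] [Lattice E] [Module ℝ E]
    [AddCommGroup F] [Lattice F] [Module ℝ F] : FremlinTerm E F → FremlinTerm E F → Prop where
  | refl (a) : FremlinRel E F a a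
  | symm {a b} : FremlinRel E F a b → FremlinRel E F b a
  | trans {a b c} : FremlinRel E F a b → FremlinRel E F b c → FremlinRel E F a c
  | add_congr {a a' b b'} : FremlinRel E F a a' → FremlinRel E F b b' →
      FremlinRel E F (add a b) (add a' b')
  | smul_congr (r : ℝ) {a a'} : FremlinRel E F a a' → FremlinRel E F (smul r a) (smul r a')
  | sup_congr {a a' b b'} : FremlinRel E F a a' → FremlinRel E F b b' →
      FremlinRel E F (sup a b) (sup a' b')
  | add_assoc (a b c) : FremlinRel E F (add (add a b) c) (add a (add b c))
  | add_comm (a b) : FremlinRel E F (add a b) (add b a)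
  | zero_add (a) : FremlinRel E F (add zero a) a
  | neg_add_cancel (a) : FremlinRel E F (add (smul (-1) a) a) zero
  | smul_add (r : ℝ) (a b) : FremlinRel E F (smul r (add a b)) (add (smul r a) (smul r b))
  | add_smul (r s : ℝ) (a) : FremlinRel E F (smul (r + s) a) (add (smul r a) (smul s a))
  | mul_smul (r s : ℝ) (a) : FremlinRel E F (smul (r * s) a) (smul r (smul s a))
  | one_smul (a) : FremlinRel E F (smul 1 a) a
  | sup_assoc (a b c) : FremlinRel E F (sup (sup a b) c) (sup a (sup b c))
  | sup_comm (a b) : FremlinRel E F (sup a b) (sup b a)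
  | sup_idem (a) : FremlinRel E F (sup a a) a
  | add_sup (a b c) : FremlinRel E F (add a (sup b c)) (sup (add a b) (add a c))
  | smul_sup (r : ℝ) (a b) : 0 ≤ r →
      FremlinRel E F (smul r (sup a b)) (sup (smul r a) (smul r b))
  | archimedean (a b) : (∀ n : ℕ, FremlinRel E F (sup (smul n a) b) b) →
      FremlinRel E F (sup a zero) zero
  | add_tmul (x x' : E) (y : F) :
      FremlinRel E F (tmul (x + x') y) (add (tmul x y) (tmul x' y))
  | tmul_add (x : E) (y y' : F) :
      FremlinRel E F (tmul x (y + y')) (add (tmul x y) (tmul x y'))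
  | smul_tmul (r : ℝ) (x : E) (y : F) : FremlinRel E F (tmul (r • x) y) (smul r (tmul x y))
  | tmul_smul (r : ℝ) (x : E) (y : F) : FremlinRel E F (tmul x (r • y)) (smul r (tmul x y))
  | sup_tmul (x x' : E) (y : F) : 0 ≤ y →
      FremlinRel E F (tmul (x ⊔ x') y) (sup (tmul x y) (tmul x' y))
  | tmul_sup (x : E) (y y' : F) : 0 ≤ x →
      FremlinRel E F (tmul x (y ⊔ y')) (sup (tmul x y) (tmul x y'))

/-- The setoid on expressions whose quotient is the Fremlin tensor product. -/
def fremlinSetoid (E F : Type*) [AddCommGroup E] [Lattice E] [Module ℝ E]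
    [AddCommGroup F] [Lattice F] [Module ℝ F] : Setoid (FremlinTerm E F) :=
  ⟨FremlinRel E F, ⟨FremlinRel.refl, FremlinRel.symm, FremlinRel.trans⟩⟩

/-- The Fremlin tensor product of the vector lattices `E` and `F`. -/
def FremlinTensor (E F : Type*) [AddCommGroup E] [Lattice E] [Module ℝ E]
    [AddCommGroup F] [Lattice F] [Module ℝ F] : Type _ :=
  Quotient (fremlinSetoid E F)

namespace FremlinTensor

section Basic

variable {E F : Type*} [AddCommGroup E] [Lattice E] [Module ℝ E]
  [AddCommGroup F] [Lattice F] [Module ℝ F]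

/-- The class of an expression. -/
def mk (a : FremlinTerm E F) : FremlinTensor E F := Quotient.mk (fremlinSetoid E F) a

theorem mk_eq {a b : FremlinTerm E F} (h : FremlinRel E F a b) : mk a = mk b := Quotient.sound h

theorem mk_eq_iff {a b : FremlinTerm E F} : mk a = mk b ↔ FremlinRel E F a b := Quotient.eq

theorem mk_surj (u : FremlinTensor E F) : ∃ a, mk a = u := Quotient.exists_rep u

instance : Zero (FremlinTensor E F) := ⟨mk .zero⟩

instance : Add (FremlinTensor E F) :=
  ⟨Quotient.map₂ .add fun _ _ h _ _ h' => FremlinRel.add_congr h h'⟩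

instance : SMul ℝ (FremlinTensor E F) :=
  ⟨fun r => Quotient.map (.smul r) fun _ _ h => FremlinRel.smul_congr r h⟩

instance : Neg (FremlinTensor E F) := ⟨fun a => (-1 : ℝ) • a⟩

/-- The supremum of two elements; the notation `⊔` is set up with the lattice structure below. -/
def vsup : FremlinTensor E F → FremlinTensor E F → FremlinTensor E F :=
  Quotient.map₂ .sup fun _ _ h _ _ h' => FremlinRel.sup_congr h h'

theorem mk_zero : mk (.zero : FremlinTerm E F) = 0 := rfl

theorem mk_add (a b : FremlinTerm E F) : mk (.add a b) = mk a + mk b := rfl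

theorem mk_smul (r : ℝ) (a : FremlinTerm E F) : mk (.smul r a) = r • mk a := rfl

instance : AddCommGroup (FremlinTensor E F) where
  add_assoc := by
    rintro ⟨a⟩ ⟨b⟩ ⟨c⟩; exact mk_eq (.add_assoc a b c)
  zero_add := by
    rintro ⟨a⟩; exact mk_eq (.zero_add a)
  add_zero := by
    rintro ⟨a⟩; exact mk_eq ((FremlinRel.add_comm _ _).trans (.zero_add a))
  add_comm := by
    rintro ⟨a⟩ ⟨b⟩; exact mk_eq (.add_comm a b)
  neg_add_cancel := by
    rintro ⟨a⟩; exact mk_eq (.neg_add_cancel a)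
  nsmul := nsmulRec
  zsmul := zsmulRec

instance : Module ℝ (FremlinTensor E F) :=
  Module.ofMinimalAxioms
    (fun r => by rintro ⟨a⟩ ⟨b⟩; exact mk_eq (.smul_add r a b))
    (fun r s => by rintro ⟨a⟩; exact mk_eq (.add_smul r s a))
    (fun r s => by rintro ⟨a⟩; exact mk_eq (.mul_smul r s a))
    (by rintro ⟨a⟩; exact mk_eq (.one_smul a))

theorem vsup_comm (u v : FremlinTensor E F) : vsup u v = vsup v u := by
  obtain ⟨a, rfl⟩ := mk_surj u
  obtain ⟨b, rfl⟩ := mk_surj v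
  exact mk_eq (.sup_comm a b)

theorem vsup_assoc (u v w : FremlinTensor E F) : vsup (vsup u v) w = vsup u (vsup v w) := by
  obtain ⟨a, rfl⟩ := mk_surj u
  obtain ⟨b, rfl⟩ := mk_surj v
  obtain ⟨c, rfl⟩ := mk_surj w
  exact mk_eq (.sup_assoc a b c)

theorem vsup_self (u : FremlinTensor E F) : vsup u u = u := by
  obtain ⟨a, rfl⟩ := mk_surj u
  exact mk_eq (.sup_idem a)

theorem add_vsup (u v w : FremlinTensor E F) : u + vsup v w = vsup (u + v) (u + w) := by
  obtain ⟨a, rfl⟩ := mk_surj u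
  obtain ⟨b, rfl⟩ := mk_surj v
  obtain ⟨c, rfl⟩ := mk_surj w
  exact mk_eq (.add_sup a b c)

theorem smul_vsup {r : ℝ} (hr : 0 ≤ r) (u v : FremlinTensor E F) :
    r • vsup u v = vsup (r • u) (r • v) := by
  obtain ⟨a, rfl⟩ := mk_surj u
  obtain ⟨b, rfl⟩ := mk_surj v
  exact mk_eq (.smul_sup r a b hr)

theorem vsup_neg {u v : FremlinTensor E F} (h : vsup u v = v) : vsup (-v) (-u) = -u := by
  have := add_vsup (-u + -v) u v
  rw [h, show -u + -v + u = -v by abel, show -u + -v + v = -u by abel] at this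
  exact this.symm

theorem vsup_left (u v : FremlinTensor E F) : vsup u (vsup u v) = vsup u v := by
  rw [← vsup_assoc, vsup_self]

theorem vsup_right (u v : FremlinTensor E F) : vsup v (vsup u v) = vsup u v := by
  rw [vsup_comm u v, vsup_left]

theorem vsup_min {u v w : FremlinTensor E F} (h : vsup u w = w) (h' : vsup v w = w) :
    vsup (vsup u v) w = w := by
  rw [vsup_assoc, h', h]

/-- The order is `u ≤ v ↔ u ⊔ v = v`, and infima are given by `u ⊓ v = -(-u ⊔ -v)`. -/
instance : Lattice (FremlinTensor E F) where
  sup := vsup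
  inf u v := -vsup (-u) (-v)
  le u v := vsup u v = v
  le_refl := vsup_self
  le_trans u v w h h' := (by rw [← h', ← vsup_assoc, h] : vsup u w = w)
  le_antisymm u v h h' := by
    rw [← show vsup u v = v from h, vsup_comm, show vsup v u = u from h']
  le_sup_left := vsup_left
  le_sup_right := vsup_right
  sup_le _ _ _ := vsup_min
  inf_le_left u v := by
    have := vsup_neg (vsup_left (-u) (-v))
    rwa [neg_neg] at this
  inf_le_right u v := by
    have := vsup_neg (vsup_right (-u) (-v))
    rwa [neg_neg] at this
  le_inf u v w h h' := by
    have := vsup_neg (vsup_min (vsup_neg h) (vsup_neg h'))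
    rwa [neg_neg] at this

theorem mk_sup (a b : FremlinTerm E F) : mk (.sup a b) = mk a ⊔ mk b := rfl

instance : IsOrderedAddMonoid (FremlinTensor E F) where
  add_le_add_left u v h w := by
    change vsup (u + w) (v + w) = v + w
    rw [add_comm u, add_comm v, ← add_vsup, show vsup u v = v from h]

instance : IsOrderedModule ℝ (FremlinTensor E F) :=
  have : PosSMulMono ℝ (FremlinTensor E F) := ⟨fun r hr u v h => by
    change vsup (r • u) (r • v) = r • v
    rw [← smul_vsup hr, show vsup u v = v from h]⟩
  IsOrderedModule.of_smul_nonneg fun r hr a ha => smul_nonneg hr ha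

instance : ArchimedeanVectorLattice (FremlinTensor E F) where
  le_zero_of_forall_nsmul_le a b h := by
    obtain ⟨a, rfl⟩ := mk_surj a
    obtain ⟨b, rfl⟩ := mk_surj b
    refine sup_eq_right.1 (mk_eq (.archimedean a b fun n => mk_eq_iff.1 ?_))
    rw [mk_sup, mk_smul, Nat.cast_smul_eq_nsmul, sup_eq_right]
    exact h n

variable (E F) in
/-- The canonical bilinear map `(x, y) ↦ x ⊗ y` from `E × F` to the Fremlin tensor product. -/
def tmul : E →ₗ[ℝ] F →ₗ[ℝ] FremlinTensor E F :=
  LinearMap.mk₂ ℝ (fun x y => mk (.tmul x y)) (fun x x' y => mk_eq (.add_tmul x x' y))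
    (fun r x y => mk_eq (.smul_tmul r x y)) (fun x y y' => mk_eq (.tmul_add x y y'))
    (fun r x y => mk_eq (.tmul_smul r x y))

theorem mk_tmul (x : E) (y : F) : mk (.tmul x y) = tmul E F x y := rfl

theorem isLatticeBimorphism_tmul : IsLatticeBimorphism (tmul E F) where
  map_sup_right x y y' hx := mk_eq (.tmul_sup x y y' hx)
  map_sup_left x x' y hy := mk_eq (.sup_tmul x x' y hy)

/-- Induction on elements of the Fremlin tensor product: as a vector lattice, it is generated by the
elementary tensors. -/
theorem induction {motive : FremlinTensor E F → Prop} (tmul : ∀ x y, motive (tmul E F x y))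
    (add : ∀ u v, motive u → motive v → motive (u + v))
    (smul : ∀ (r : ℝ) u, motive u → motive (r • u))
    (sup : ∀ u v, motive u → motive v → motive (u ⊔ v)) (u : FremlinTensor E F) : motive u := by
  obtain ⟨a, rfl⟩ := mk_surj u
  induction a with
  | tmul x y => exact tmul x y
  | zero => simpa [mk_zero] using tmul 0 0
  | add a b ha hb => exact add _ _ ha hb
  | smul r a ha => exact smul r _ ha
  | sup a b ha hb => exact sup _ _ ha hb

end Basic

section Lift

variable {E F G : Type*} [AddCommGroup E] [Lattice E] [Module ℝ E]
  [AddCommGroup F] [Lattice F] [Module ℝ F]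
  [AddCommGroup G] [Lattice G] [IsOrderedAddMonoid G] [Module ℝ G] [IsOrderedModule ℝ G]

/-- The value of an expression under a bilinear map. -/
def eval (Φ : E →ₗ[ℝ] F →ₗ[ℝ] G) : FremlinTerm E F → G
  | .tmul x y => Φ x y
  | .zero => 0
  | .add a b => eval Φ a + eval Φ b
  | .smul r a => r • eval Φ a
  | .sup a b => eval Φ a ⊔ eval Φ b

theorem eval_eq [ArchimedeanVectorLattice G] {Φ : E →ₗ[ℝ] F →ₗ[ℝ] G} (hΦ : IsLatticeBimorphism Φ)
    {a b : FremlinTerm E F} (h : FremlinRel E F a b) : eval Φ a = eval Φ b := by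
  induction h with
  | refl a => rfl
  | symm _ ih => exact ih.symm
  | trans _ _ ih ih' => exact ih.trans ih'
  | add_congr _ _ ih ih' => simp only [eval, ih, ih']
  | smul_congr r _ ih => simp only [eval, ih]
  | sup_congr _ _ ih ih' => simp only [eval, ih, ih']
  | add_assoc a b c => exact _root_.add_assoc _ _ _
  | add_comm a b => exact _root_.add_comm _ _
  | zero_add a => exact _root_.zero_add _
  | neg_add_cancel a => simp [eval]
  | smul_add r a b => exact _root_.smul_add _ _ _
  | add_smul r s a => exact _root_.add_smul _ _ _
  | mul_smul r s a => exact SemigroupAction.mul_smul _ _ _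
  | one_smul a => exact _root_.one_smul _ _
  | sup_assoc a b c => exact _root_.sup_assoc _ _ _
  | sup_comm a b => exact _root_.sup_comm _ _
  | sup_idem a => exact _root_.sup_idem _
  | add_sup a b c => exact _root_.add_sup _ _ _
  | smul_sup r a b hr =>
    rcases hr.eq_or_lt with rfl | hr
    · simp [eval]
    · exact (OrderIso.smulRight hr).map_sup _ _
  | archimedean a b _ ih =>
    refine sup_eq_right.2 (ArchimedeanVectorLattice.le_zero_of_forall_nsmul_le _ (eval Φ b) ?_)
    intro n
    have h := sup_eq_right.1 (ih n)
    simpa only [eval, Nat.cast_smul_eq_nsmul] using h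
  | add_tmul x x' y => simp [eval]
  | tmul_add x y y' => simp [eval]
  | smul_tmul r x y => simp [eval]
  | tmul_smul r x y => simp [eval]
  | sup_tmul x x' y hy => exact hΦ.map_sup_left x x' y hy
  | tmul_sup x y y' hx => exact hΦ.map_sup_right x y y' hx

/-- The universal property of the Fremlin tensor product: every lattice bimorphism into an
Archimedean vector lattice factors through `tmul` by a unique lattice homomorphism. -/
theorem existsUnique_lift [ArchimedeanVectorLattice G] (Φ : E →ₗ[ℝ] F →ₗ[ℝ] G)
    (hΦ : IsLatticeBimorphism Φ) :
    ∃! T : FremlinTensor E F →ₗ[ℝ] G,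
      ((∀ u v, T (u ⊔ v) = T u ⊔ T v) ∧ ∀ u v, T (u ⊓ v) = T u ⊓ T v) ∧
        ∀ x y, T (tmul E F x y) = Φ x y := by
  let T : FremlinTensor E F →ₗ[ℝ] G :=
    { toFun := Quotient.lift (eval Φ) fun _ _ h => eval_eq hΦ h
      map_add' := by rintro ⟨a⟩ ⟨b⟩; rfl
      map_smul' := by rintro r ⟨a⟩; rfl }
  have hsup : ∀ u v, T (u ⊔ v) = T u ⊔ T v := by rintro ⟨a⟩ ⟨b⟩; rfl
  refine ⟨T, ⟨⟨hsup, fun u v => ?_⟩, fun x y => rfl⟩, ?_⟩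
  · have h : u ⊓ v = -(-u ⊔ -v) := rfl
    rw [h, map_neg, hsup, map_neg, map_neg, neg_sup, neg_neg, neg_neg]
  · rintro S ⟨⟨hS, -⟩, hS'⟩
    ext u
    induction u using FremlinTensor.induction with
    | tmul x y => exact hS' x y
    | add u v hu hv => rw [map_add, map_add, hu, hv]
    | smul r u hu => rw [map_smul, map_smul, hu]
    | sup u v hu hv => rw [hS, hsup, hu, hv]

end Lift

end FremlinTensor

/-! ### Locally convex-solid topologies and Riesz seminorms -/

/-- A locally convex-solid vector lattice: a linear topology with a base at zero of convex solid
sets. No Hausdorff assumption. -/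
class LocallyConvexSolid (E : Type*) [AddCommGroup E] [Lattice E] [Module ℝ E]
    [TopologicalSpace E] : Prop extends IsTopologicalAddGroup E, ContinuousSMul ℝ E where
  hasBasis_nhds_zero : (𝓝 (0 : E)).HasBasis
    (fun U => U ∈ 𝓝 (0 : E) ∧ Convex ℝ U ∧ LatticeOrderedAddCommGroup.IsSolid U) id

/-- A Riesz seminorm: `|x| ≤ |y|` implies `p x ≤ p y`. -/
def IsRieszSeminorm {E : Type*} [AddCommGroup E] [Lattice E] [Module ℝ E]
    (p : Seminorm ℝ E) : Prop :=
  ∀ x y : E, |x| ≤ |y| → p x ≤ p y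

/-! ### The seminorm `p ⊗ q` -/

section TensorSeminorm

variable {E F : Type*}
  [AddCommGroup E] [Lattice E] [IsOrderedAddMonoid E] [Module ℝ E] [IsOrderedModule ℝ E]
  [AddCommGroup F] [Lattice F] [IsOrderedAddMonoid F] [Module ℝ F] [IsOrderedModule ℝ F]

/-- For the closed unit balls `U = {p ≤ 1}` and `V = {q ≤ 1}`, the convex balanced hull of the solid
hull of `U ⊗ V = {x ⊗ y : x ∈ U, y ∈ V}`. -/
def tensorBall (p : Seminorm ℝ E) (q : Seminorm ℝ F) : Set (FremlinTensor E F) :=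
  absConvexHull ℝ (LatticeOrderedAddCommGroup.solidClosure
    (Set.image2 (fun x y => FremlinTensor.tmul E F x y) {x | p x ≤ 1} {y | q y ≤ 1}))

namespace FremlinTensor

set_option linter.unusedSectionVars false in
theorem tmul_mono {x x' : E} {y y' : F} (hx : 0 ≤ x) (hxx' : x ≤ x') (hy : 0 ≤ y) (hyy' : y ≤ y') :
    tmul E F x y ≤ tmul E F x' y' := by
  have h1 : tmul E F x y ≤ tmul E F x y' := by
    rw [← sup_eq_right, ← isLatticeBimorphism_tmul.map_sup_right x y y' hx, sup_eq_right.2 hyy']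
  have h2 : tmul E F x y' ≤ tmul E F x' y' := by
    rw [← sup_eq_right, ← isLatticeBimorphism_tmul.map_sup_left x x' y' (hy.trans hyy'),
      sup_eq_right.2 hxx']
  exact h1.trans h2

set_option linter.unusedSectionVars false in
theorem abs_tmul_le (x : E) (y : F) : |tmul E F x y| ≤ tmul E F |x| |y| := by
  have key : ∀ y : F, ∀ x : E, 0 ≤ x → |tmul E F x y| = tmul E F x |y| := by
    intro y x hx
    rw [abs, abs, isLatticeBimorphism_tmul.map_sup_right x y (-y) hx, map_neg]
  have h : |tmul E F x y| ≤ |tmul E F |x| y| ⊔ tmul E F |x| |y| := by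
    refine le_sup_of_le_right ?_
    have hx : x = x⁺ - x⁻ := (posPart_sub_negPart x).symm
    calc |tmul E F x y| = |tmul E F x⁺ y - tmul E F x⁻ y| := by
          conv_lhs => rw [hx, map_sub, LinearMap.sub_apply]
      _ ≤ |tmul E F x⁺ y| + |tmul E F x⁻ y| := by
          rw [sub_eq_add_neg]
          refine (abs_add_le _ _).trans ?_
          rw [abs_neg]
      _ = tmul E F |x| |y| := by
          rw [key y _ (posPart_nonneg x), key y _ (negPart_nonneg x), ← LinearMap.add_apply,
            ← map_add, posPart_add_negPart]
  rwa [key y _ (abs_nonneg x), sup_idem] at h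

set_option linter.unusedSectionVars false in
theorem abs_smul_le (r : ℝ) (u : FremlinTensor E F) : |r • u| ≤ |r| • |u| := by
  have key : ∀ v : FremlinTensor E F, r • v ≤ |r| • |v| := by
    intro v
    rcases le_total 0 r with hr | hr
    · rw [abs_of_nonneg hr]
      exact smul_le_smul_of_nonneg_left (le_abs_self v) hr
    · rw [abs_of_nonpos hr, ← neg_smul_neg r v]
      exact smul_le_smul_of_nonneg_left (neg_le_abs v) (neg_nonneg.2 hr)
  refine abs_le'.2 ⟨key u, ?_⟩
  rw [← smul_neg, ← abs_neg u]
  exact key (-u)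

/-- Every element is dominated by an elementary tensor of positive elements. -/
theorem exists_abs_le_tmul (u : FremlinTensor E F) :
    ∃ (x : E) (y : F), 0 ≤ x ∧ 0 ≤ y ∧ |u| ≤ tmul E F x y := by
  have join : ∀ (x x' : E) (y y' : F), 0 ≤ x → 0 ≤ y → 0 ≤ x' → 0 ≤ y' →
      tmul E F x y + tmul E F x' y' ≤ tmul E F (x + x') (y + y') := by
    intro x x' y y' hx hy hx' hy'
    rw [map_add (tmul E F) x x', LinearMap.add_apply]
    exact add_le_add (tmul_mono hx le_rfl hy (le_add_of_nonneg_right hy'))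
      (tmul_mono hx' le_rfl hy' (le_add_of_nonneg_left hy))
  induction u using FremlinTensor.induction with
  | tmul x y => exact ⟨|x|, |y|, abs_nonneg x, abs_nonneg y, abs_tmul_le x y⟩
  | add u v hu hv =>
    obtain ⟨x, y, hx, hy, h⟩ := hu
    obtain ⟨x', y', hx', hy', h'⟩ := hv
    exact ⟨x + x', y + y', add_nonneg hx hx', add_nonneg hy hy',
      (abs_add_le u v).trans ((add_le_add h h').trans (join _ _ _ _ hx hy hx' hy'))⟩
  | smul r u hu =>
    obtain ⟨x, y, hx, hy, h⟩ := hu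
    refine ⟨|r| • x, y, smul_nonneg (abs_nonneg r) hx, hy, ?_⟩
    rw [map_smul, LinearMap.smul_apply]
    refine (abs_smul_le r u).trans ?_
    exact smul_le_smul_of_nonneg_left h (abs_nonneg r)
  | sup u v hu hv =>
    obtain ⟨x, y, hx, hy, h⟩ := hu
    obtain ⟨x', y', hx', hy', h'⟩ := hv
    refine ⟨x + x', y + y', add_nonneg hx hx', add_nonneg hy hy', ?_⟩
    have hsup : |u ⊔ v| ≤ |u| + |v| := by
      refine abs_le'.2 ⟨sup_le ((le_abs_self u).trans (le_add_of_nonneg_right (abs_nonneg v)))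
        ((le_abs_self v).trans (le_add_of_nonneg_left (abs_nonneg u))), ?_⟩
      rw [neg_sup]
      exact inf_le_left.trans ((neg_le_abs u).trans (le_add_of_nonneg_right (abs_nonneg v)))
    exact hsup.trans ((add_le_add h h').trans (join _ _ _ _ hx hy hx' hy'))

end FremlinTensor

theorem absorbent_tensorBall (p : Seminorm ℝ E) (q : Seminorm ℝ F) :
    Absorbent ℝ (tensorBall p q) := by
  intro u
  obtain ⟨x, y, hx, hy, h⟩ := FremlinTensor.exists_abs_le_tmul u
  have hp : 0 < p x + 1 := by positivity
  have hq : 0 < q y + 1 := by positivity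
  have hmem : ((p x + 1) * (q y + 1))⁻¹ • u ∈ tensorBall p q := by
    refine subset_absConvexHull ⟨FremlinTensor.tmul E F ((p x + 1)⁻¹ • x) ((q y + 1)⁻¹ • y),
      ⟨_, ?_, _, ?_, rfl⟩, ?_⟩
    · rw [Set.mem_ofPred_eq, map_smul_eq_mul, Real.norm_of_nonneg (by positivity),
        inv_mul_le_iff₀ hp]
      linarith
    · rw [Set.mem_ofPred_eq, map_smul_eq_mul, Real.norm_of_nonneg (by positivity),
        inv_mul_le_iff₀ hq]
      linarith
    · rw [map_smul, map_smul, LinearMap.smul_apply, smul_smul, ← mul_inv,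
        mul_comm (q y + 1)]
      refine (FremlinTensor.abs_smul_le _ u).trans (le_trans ?_ (le_abs_self _))
      rw [abs_of_nonneg (by positivity : 0 ≤ ((p x + 1) * (q y + 1))⁻¹)]
      exact smul_le_smul_of_nonneg_left h (by positivity)
  have hb : Balanced ℝ (tensorBall p q) := balanced_absConvexHull
  set t : ℝ := (p x + 1) * (q y + 1) with ht
  have ht0 : 0 < t := mul_pos hp hq
  refine Absorbs.of_norm ⟨t, fun c hc => Set.singleton_subset_iff.2 ?_⟩
  have hc0 : 0 < ‖c‖ := ht0.trans_le hc
  rw [Set.mem_smul_set_iff_inv_smul_mem₀ (norm_pos_iff.1 hc0)]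
  have := hb.smul_mem (a := c⁻¹ * t) (by
    rw [norm_mul, norm_inv, Real.norm_of_nonneg ht0.le, inv_mul_le_iff₀ hc0]
    linarith) hmem
  rwa [smul_smul, mul_assoc, mul_inv_cancel₀ ht0.ne', mul_one] at this

/-- The seminorm `p ⊗ q` on the Fremlin tensor product:
`(p ⊗ q)(u) = inf {r > 0 : u ∈ r • tensorBall p q}`, the Minkowski functional of `tensorBall p q`. -/
noncomputable def tensorSeminorm (p : Seminorm ℝ E) (q : Seminorm ℝ F) :
    Seminorm ℝ (FremlinTensor E F) :=
  gaugeSeminorm (s := tensorBall p q) balanced_absConvexHull convex_absConvexHull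
    (absorbent_tensorBall p q)

/-- The defining formula of `p ⊗ q`. -/
theorem tensorSeminorm_apply (p : Seminorm ℝ E) (q : Seminorm ℝ F) (u : FremlinTensor E F) :
    tensorSeminorm p q u = sInf {r : ℝ | 0 < r ∧ u ∈ r • tensorBall p q} := rfl

end TensorSeminorm

/-! The upper bound is scaling: for `ε > 0`, dividing the factors by `p x + ε` and `q y + ε` puts
the tensor in the ball.

For the lower bound, Hahn-Banach gives positive functionals `f` and `g` with `f |x| = p x`, `g |y| =
q y`, `f |·| ≤ p` and `g |·| ≤ q`. Let `μ` be the functional `f ⊗ g` on the algebraic tensor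
product. The ball lies in the absolutely convex set of all `u` with `|u|` below the image of some
`w` with `μ w ≤ 1`. If `x ⊗ y = s v` with `v` in the ball, then `|x| ⊗ |y| = |x ⊗ y|` lies below the
image of such an `s w`, and monotonicity of `μ` gives `p x * q y ≤ s`.

The crux is this monotonicity (`lift_nonneg_of_positive`): if `∑ xᵢ ⊗ yᵢ ≥ 0` in the Fremlin tensor
product, then `∑ f xᵢ * g yᵢ ≥ 0`. Put `e = ∑ |xᵢ|` and `d = ∑ |yᵢ|`. In a principal ideal of an
Archimedean lattice the real lattice characters detect the order (`nonpos_of_forall_character`), so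
it is enough that `∑ φ xᵢ * ψ yᵢ ≥ 0` for all characters `φ`, `ψ` of the two ideals: for fixed `ψ`
this says `∑ ψ yᵢ • xᵢ ≥ 0`, so `f` can be applied, and then `g` in the same way.

The inequality for characters comes from the universal property (`sum_characters_nonneg`). A
character need not extend finitely to all of `E`, but each `x` has a finite value at all characters
off a meagre set. Products of such values thus form a lattice bimorphism into germs of real
functions along the residual filter, an Archimedean lattice. The induced homomorphism gives the
inequality on a residual set of pairs, and Baire's theorem and continuity extend it to every pair.
-/

set_option linter.unusedSectionVars false

/-! ### Elementary inequalities in vector lattices -/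

section VectorLattice

variable {V : Type*} [AddCommGroup V] [Lattice V] [IsOrderedAddMonoid V] [Module ℝ V]
  [IsOrderedModule ℝ V]

theorem smul_sup_of_nonneg {r : ℝ} (hr : 0 ≤ r) (x y : V) : r • (x ⊔ y) = r • x ⊔ r • y := by
  rcases hr.eq_or_lt with rfl | hr
  · simp
  · exact (OrderIso.smulRight hr).map_sup _ _

theorem smul_inf_of_nonneg {r : ℝ} (hr : 0 ≤ r) (x y : V) : r • (x ⊓ y) = r • x ⊓ r • y := by
  rcases hr.eq_or_lt with rfl | hr
  · simp
  · exact (OrderIso.smulRight hr).map_inf _ _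

theorem abs_smul_of_nonneg {r : ℝ} (hr : 0 ≤ r) (x : V) : |r • x| = r • |x| := by
  rw [abs, abs, smul_sup_of_nonneg hr, smul_neg]

theorem abs_real_smul (r : ℝ) (x : V) : |r • x| = |r| • |x| := by
  rcases le_total 0 r with hr | hr
  · rw [abs_of_nonneg hr, abs_smul_of_nonneg hr]
  · rw [abs_of_nonpos hr, ← abs_neg, ← neg_smul, abs_smul_of_nonneg (neg_nonneg.2 hr)]

theorem sup_smul_of_nonneg {e : V} (he : 0 ≤ e) (r s : ℝ) : (r ⊔ s) • e = r • e ⊔ s • e := by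
  rcases le_total r s with h | h
  · rw [sup_of_le_right h, sup_of_le_right (smul_le_smul_of_nonneg_right h he)]
  · rw [sup_of_le_left h, sup_of_le_left (smul_le_smul_of_nonneg_right h he)]

theorem abs_sup_le_add (x y : V) : |x ⊔ y| ≤ |x| + |y| := by
  refine abs_le'.2 ⟨sup_le ((le_abs_self x).trans (le_add_of_nonneg_right (abs_nonneg y)))
    ((le_abs_self y).trans (le_add_of_nonneg_left (abs_nonneg x))), ?_⟩
  rw [neg_sup]
  exact inf_le_left.trans ((neg_le_abs x).trans (le_add_of_nonneg_right (abs_nonneg y)))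

theorem abs_sup_sub_sup_le (x y x' y' : V) :
    |x ⊔ y - x' ⊔ y'| ≤ |x - x'| + |y - y'| := by
  have h : x ⊔ y - x' ⊔ y' = (x ⊔ y - x' ⊔ y) + (y ⊔ x' - y' ⊔ x') := by
    rw [sup_comm y x', sup_comm y' x']; abel
  rw [h]
  exact (abs_add_le _ _).trans
    (add_le_add (abs_sup_sub_sup_le_abs x x' y) (abs_sup_sub_sup_le_abs y y' x'))

theorem add_inf_le_inf_add_inf {a b e : V} (ha : 0 ≤ a) (hb : 0 ≤ b) (he : 0 ≤ e) :
    (a + b) ⊓ e ≤ a ⊓ e + b ⊓ e := by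
  rw [add_inf, inf_add, inf_add]
  refine le_inf (le_inf inf_le_left ?_) (le_inf ?_ ?_)
  · exact inf_le_right.trans (le_add_of_nonneg_right hb)
  · exact inf_le_right.trans (le_add_of_nonneg_left ha)
  · exact inf_le_right.trans (le_add_of_nonneg_left he)

/-- This is what makes the infimum of `{t | x ≤ t • e}` attained. -/
theorem le_smul_of_forall_pos [ArchimedeanVectorLattice V] {x e : V} {t : ℝ}
    (h : ∀ ε : ℝ, 0 < ε → x ≤ (t + ε) • e) : x ≤ t • e := by
  rw [← sub_nonpos]
  refine ArchimedeanVectorLattice.le_zero_of_forall_nsmul_le _ (|e|) fun n => ?_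
  have hn : (0 : ℝ) < n + 1 := by positivity
  -- With `ε = 1 / (n + 1)`, the `n`-th multiple of the excess `x - t • e` stays below `|e|`.
  have h1 := h (n + 1 : ℝ)⁻¹ (by positivity)
  rw [add_smul, ← sub_le_iff_le_add'] at h1
  have h2 : (n : ℝ) • (x - t • e) ≤ (n : ℝ) • ((n + 1 : ℝ)⁻¹ • e) :=
    smul_le_smul_of_nonneg_left h1 n.cast_nonneg
  rw [← Nat.cast_smul_eq_nsmul ℝ]
  refine h2.trans ?_
  rw [smul_smul]
  refine (le_abs_self _).trans ?_
  rw [abs_real_smul, abs_of_nonneg (by positivity)]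
  calc ((n : ℝ) * (n + 1 : ℝ)⁻¹) • |e| ≤ (1 : ℝ) • |e| := by
        refine smul_le_smul_of_nonneg_right ?_ (abs_nonneg e)
        rw [mul_inv_le_iff₀ hn]; linarith
    _ = |e| := one_smul _ _

end VectorLattice

/-! ### Characters of a vector lattice with a strong unit -/

section Character

variable {V : Type*} [AddCommGroup V] [Lattice V] [Module ℝ V]

/-- A sublinear functional that preserves finite suprema and is normalised at `e`. -/
structure IsSupSublinear (e : V) (ρ : V → ℝ) : Prop where
  add_le : ∀ x y, ρ (x + y) ≤ ρ x + ρ y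
  smul_le : ∀ (r : ℝ) x, 0 < r → ρ (r • x) ≤ r * ρ x
  mono : ∀ x y, x ≤ y → ρ x ≤ ρ y
  sup_le : ∀ x y, ρ (x ⊔ y) ≤ ρ x ⊔ ρ y
  unit : ∀ r : ℝ, ρ (r • e) = r

/-- The lattice characters: real lattice homomorphisms with value `1` at `e`. -/
def latticeCharacters (e : V) : Set (V → ℝ) :=
  {φ | (∀ x y, φ (x + y) = φ x + φ y) ∧ (∀ (r : ℝ) x, φ (r • x) = r * φ x) ∧
    (∀ x y, φ (x ⊔ y) = φ x ⊔ φ y) ∧ φ e = 1}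

variable [IsOrderedAddMonoid V] [IsOrderedModule ℝ V] {e : V}

theorem bddBelow_range_of_mono {ι : Type*} (hunit : ∀ x : V, ∃ r : ℝ, x ≤ r • e)
    {σ : ι → V → ℝ} (mono : ∀ i x y, x ≤ y → σ i x ≤ σ i y)
    (le_unit : ∀ i (r : ℝ), r ≤ σ i (r • e)) (x : V) :
    BddBelow (Set.range fun i => σ i x) := by
  obtain ⟨r, hr⟩ := hunit (-x)
  refine ⟨-r, ?_⟩
  rintro _ ⟨i, rfl⟩
  refine (le_unit i (-r)).trans (mono i _ _ ?_)
  rw [neg_smul]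
  exact neg_le.1 hr

/-- The infimum of a directed family is a supremum-preserving sublinear functional. -/
theorem IsSupSublinear.iInf {ι : Type*} [Nonempty ι] (hunit : ∀ x : V, ∃ r : ℝ, x ≤ r • e)
    {σ : ι → V → ℝ} (mono : ∀ i x y, x ≤ y → σ i x ≤ σ i y)
    (le_unit : ∀ i (r : ℝ), r ≤ σ i (r • e))
    (add : ∀ i j x y, ∃ k, σ k (x + y) ≤ σ i x + σ j y)
    (smul : ∀ i (r : ℝ) x, 0 < r → ∃ k, σ k (r • x) ≤ r * σ i x)
    (sup : ∀ i j x y, ∃ k, σ k (x ⊔ y) ≤ σ i x ⊔ σ j y)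
    (unit : ∀ r : ℝ, ∃ i, σ i (r • e) ≤ r) :
    IsSupSublinear e fun x => ⨅ i, σ i x := by
  have bdd := bddBelow_range_of_mono hunit mono le_unit
  refine ⟨fun x y => ?_, fun r x hr => ?_, fun x y h => ?_, fun x y => ?_, fun r => ?_⟩
  · refine le_of_forall_pos_le_add fun ε hε => ?_
    obtain ⟨i, hi⟩ := exists_lt_of_ciInf_lt (lt_add_of_pos_right (⨅ i, σ i x) (half_pos hε))
    obtain ⟨j, hj⟩ := exists_lt_of_ciInf_lt (lt_add_of_pos_right (⨅ i, σ i y) (half_pos hε))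
    obtain ⟨k, hk⟩ := add i j x y
    have := ciInf_le (bdd (x + y)) k
    linarith
  · rw [← div_le_iff₀' hr]
    refine le_ciInf fun i => ?_
    obtain ⟨k, hk⟩ := smul i r x hr
    rw [div_le_iff₀' hr]
    exact (ciInf_le (bdd (r • x)) k).trans hk
  · exact ciInf_mono (bdd x) fun i => mono i x y h
  · refine le_of_forall_pos_le_add fun ε hε => ?_
    obtain ⟨i, hi⟩ := exists_lt_of_ciInf_lt (lt_add_of_pos_right (⨅ i, σ i x) hε)
    obtain ⟨j, hj⟩ := exists_lt_of_ciInf_lt (lt_add_of_pos_right (⨅ i, σ i y) hε)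
    obtain ⟨k, hk⟩ := sup i j x y
    refine (ciInf_le (bdd (x ⊔ y)) k).trans (hk.trans (_root_.sup_le ?_ ?_))
    · exact hi.le.trans (add_le_add_left le_sup_left ε)
    · exact hj.le.trans (add_le_add_left le_sup_right ε)
  · obtain ⟨i, hi⟩ := unit r
    exact le_antisymm ((ciInf_le (bdd _) i).trans hi) (le_ciInf fun i => le_unit i r)

namespace IsSupSublinear

variable {ρ : V → ℝ}

theorem map_zero (hρ : IsSupSublinear e ρ) : ρ 0 = 0 := by simpa using hρ.unit 0

theorem map_add_unit (hρ : IsSupSublinear e ρ) (x : V) (r : ℝ) : ρ (x + r • e) = ρ x + r := by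
  refine le_antisymm ((hρ.add_le _ _).trans_eq (by rw [hρ.unit])) ?_
  have := hρ.add_le (x + r • e) ((-r) • e)
  rw [hρ.unit, neg_smul, add_neg_cancel_right] at this
  linarith

/-- Subtracting the supremum `ρ y` from `y` and taking the negative part does not change `ρ`. -/
theorem map_sub_unit_inf (hρ : IsSupSublinear e ρ) (y : V) : ρ ((y - ρ y • e) ⊓ 0) = 0 := by
  set a := y - ρ y • e with ha
  have h0 : ρ a = 0 := by
    rw [ha, sub_eq_add_neg, ← neg_smul, hρ.map_add_unit, add_neg_cancel]
  refine le_antisymm ((hρ.mono _ _ inf_le_right).trans_eq hρ.map_zero) ?_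
  -- Since `a = a ⊓ 0 + a ⊔ 0` and `ρ (a ⊔ 0) ≤ 0`, subadditivity leaves `0 = ρ a ≤ ρ (a ⊓ 0)`.
  have h1 := hρ.add_le (a ⊓ 0) (a ⊔ 0)
  rw [inf_add_sup, add_zero, h0] at h1
  have h2 := hρ.sup_le a 0
  rw [h0, hρ.map_zero, sup_idem] at h2
  linarith

/-- Localisation of `ρ` to the zero set of `z`. -/
theorem localize (hunit : ∀ x : V, ∃ r : ℝ, x ≤ r • e) (hρ : IsSupSublinear e ρ) {z : V}
    (hz : z ≤ 0) (hρz : ρ z = 0) :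
    ∃ σ, IsSupSublinear e σ ∧ (∀ x, σ x ≤ ρ (x + z)) ∧ σ ≤ ρ := by
  -- The localisation is `σ x = inf_{t ≥ 0} ρ (x + t • z)`: as `t` grows, the penalty `t • z ≤ 0`
  -- suppresses everything off the zero set of `z`.
  have mono : ∀ (t : {t : ℝ // 0 ≤ t}) x y, x ≤ y → ρ (x + t.1 • z) ≤ ρ (y + t.1 • z) :=
    fun t x y h => hρ.mono _ _ (add_le_add_left h _)
  have le_unit : ∀ (t : {t : ℝ // 0 ≤ t}) (r : ℝ), r ≤ ρ (r • e + t.1 • z) := by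
    rintro ⟨t, ht⟩ r
    rw [add_comm, hρ.map_add_unit]
    rcases ht.eq_or_lt with rfl | ht
    · simp [hρ.map_zero]
    · have := hρ.smul_le t⁻¹ (t • z) (inv_pos.2 ht)
      rw [inv_smul_smul₀ ht.ne', hρz] at this
      have := (mul_nonneg_iff_of_pos_left (inv_pos.2 ht)).1 this
      linarith
  have anti : ∀ (x : V) (s t : ℝ), s ≤ t → ρ (x + t • z) ≤ ρ (x + s • z) := by
    intro x s t hst
    refine hρ.mono _ _ (add_le_add_right ?_ x)
    rw [← sub_nonneg, ← sub_smul, ← neg_smul_neg]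
    exact (smul_nonneg (sub_nonneg.2 hst) (neg_nonneg.2 hz)).trans_eq
      (by rw [neg_sub, smul_neg, ← neg_smul, neg_sub])
  have : Nonempty {t : ℝ // 0 ≤ t} := ⟨⟨0, le_rfl⟩⟩
  have bdd := bddBelow_range_of_mono hunit (σ := fun (t : {t : ℝ // 0 ≤ t}) x => ρ (x + t.1 • z))
    mono le_unit
  refine ⟨fun x => ⨅ t : {t : ℝ // 0 ≤ t}, ρ (x + t.1 • z),
    IsSupSublinear.iInf hunit mono le_unit ?_ ?_ ?_ ?_, fun x => ?_, fun x => ?_⟩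
  · rintro ⟨s, hs⟩ ⟨t, ht⟩ x y
    refine ⟨⟨s + t, add_nonneg hs ht⟩, ?_⟩
    have := hρ.add_le (x + s • z) (y + t • z)
    rwa [add_add_add_comm, ← add_smul] at this
  · rintro ⟨s, hs⟩ r x hr
    refine ⟨⟨r * s, mul_nonneg hr.le hs⟩, ?_⟩
    have := hρ.smul_le r (x + s • z) hr
    rwa [smul_add, smul_smul] at this
  · rintro ⟨s, hs⟩ ⟨t, ht⟩ x y
    refine ⟨⟨s ⊔ t, hs.trans le_sup_left⟩, ?_⟩
    change ρ (x ⊔ y + (s ⊔ t) • z) ≤ ρ (x + s • z) ⊔ ρ (y + t • z)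
    rw [sup_add]
    exact (hρ.sup_le _ _).trans (sup_le_sup (anti _ _ _ le_sup_left) (anti _ _ _ le_sup_right))
  · exact fun r => ⟨⟨0, le_rfl⟩, by simp [hρ.unit]⟩
  · simpa using ciInf_le (bdd x) ⟨1, zero_le_one⟩
  · simpa using ciInf_le (bdd x) ⟨0, le_rfl⟩

/-- Below every supremum-preserving sublinear functional there is a character. -/
theorem exists_character_le (hunit : ∀ x : V, ∃ r : ℝ, x ≤ r • e) (hρ : IsSupSublinear e ρ) :
    ∃ φ ∈ latticeCharacters e, φ ≤ ρ := by
  -- The order dual turns Zorn's lemma into the existence of a minimal functional below `ρ`;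
  -- minimality will force additivity.
  obtain ⟨m, hmρ, hm⟩ := zorn_le_nonempty₀ (α := (V → ℝ)ᵒᵈ)
    {σ | IsSupSublinear e (OrderDual.ofDual σ)}
    (fun c hc hchain y hy => by
      have : Nonempty c := ⟨⟨y, hy⟩⟩
      have mono : ∀ (i : c) x y, x ≤ y → OrderDual.ofDual i.1 x ≤ OrderDual.ofDual i.1 y :=
        fun i => (hc i.2).mono
      have le_unit : ∀ (i : c) (r : ℝ), r ≤ OrderDual.ofDual i.1 (r • e) :=
        fun i r => ((hc i.2).unit r).ge
      have dir : ∀ i j : c, ∃ k : c, OrderDual.ofDual k.1 ≤ OrderDual.ofDual i.1 ∧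
          OrderDual.ofDual k.1 ≤ OrderDual.ofDual j.1 := fun i j => by
        rcases hchain.total i.2 j.2 with h | h
        · exact ⟨j, h, le_rfl⟩
        · exact ⟨i, le_rfl, h⟩
      refine ⟨OrderDual.toDual fun x => ⨅ i : c, OrderDual.ofDual i.1 x,
        IsSupSublinear.iInf hunit mono le_unit ?_ ?_ ?_ ?_, ?_⟩
      · intro i j x y
        obtain ⟨k, hki, hkj⟩ := dir i j
        exact ⟨k, ((hc k.2).add_le x y).trans (add_le_add (hki x) (hkj y))⟩
      · exact fun i r x hr => ⟨i, (hc i.2).smul_le r x hr⟩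
      · intro i j x y
        obtain ⟨k, hki, hkj⟩ := dir i j
        exact ⟨k, ((hc k.2).sup_le x y).trans (sup_le_sup (hki x) (hkj y))⟩
      · exact fun r => ⟨⟨y, hy⟩, ((hc hy).unit r).le⟩
      · exact fun z hz x => ciInf_le (bddBelow_range_of_mono hunit mono le_unit x) ⟨z, hz⟩)
    (OrderDual.toDual ρ) hρ
  set φ : V → ℝ := OrderDual.ofDual m
  have hφ : IsSupSublinear e φ := hm.prop
  have add : ∀ x y, φ (x + y) = φ x + φ y := fun x y => by
    refine le_antisymm (hφ.add_le x y) ?_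
    -- Localising at the points where `y` attains `φ y` cannot lower the minimal `φ`. Hence `φ x ≤ σ
    -- x ≤ φ (x + z) ≤ φ (x + y) - φ y`, the missing superadditivity.
    set z := (y - φ y • e) ⊓ 0
    obtain ⟨σ, hσ, hσz, hσφ⟩ := hφ.localize hunit (inf_le_right : z ≤ 0) (hφ.map_sub_unit_inf y)
    have h1 : φ x ≤ σ x := hm.le_of_ge (y := OrderDual.toDual σ) hσ hσφ x
    have h2 : φ (x + z) ≤ φ (x + (y - φ y • e)) := hφ.mono _ _ (add_le_add_right inf_le_left x)
    rw [← add_sub_assoc, sub_eq_add_neg, ← neg_smul, hφ.map_add_unit] at h2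
    linarith [hσz x]
  have neg : ∀ x, φ (-x) = -φ x := fun x => by
    have := add x (-x)
    rw [add_neg_cancel, hφ.map_zero] at this
    linarith
  have smul_pos : ∀ (r : ℝ) x, 0 < r → φ (r • x) = r * φ x := fun r x hr => by
    refine le_antisymm (hφ.smul_le r x hr) ?_
    have := hφ.smul_le r (-x) hr
    rw [smul_neg, neg, neg] at this
    linarith
  refine ⟨φ, ⟨add, fun r x => ?_, fun x y => ?_, by simpa using hφ.unit 1⟩, hmρ⟩
  · rcases lt_trichotomy r 0 with hr | rfl | hr
    · have := smul_pos (-r) x (neg_pos.2 hr)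
      rw [neg_smul, neg] at this
      linarith
    · simp [hφ.map_zero]
    · exact smul_pos r x hr
  · exact le_antisymm (hφ.sup_le x y)
      (_root_.sup_le (hφ.mono _ _ le_sup_left) (hφ.mono _ _ le_sup_right))

end IsSupSublinear

variable [ArchimedeanVectorLattice V]

/-- The functional is `x ↦ inf {t | x ≤ t • e}`, the maximum of `x` as a function on the character
space. The Archimedean property makes the infimum attained, and `e ≠ 0` makes `r ↦ r • e` an order
embedding. -/
theorem exists_isSupSublinear (he : 0 ≤ e) (hunit : ∀ x : V, ∃ r : ℝ, x ≤ r • e) (hne : e ≠ 0) :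
    ∃ ρ, IsSupSublinear e ρ ∧ ∀ x (t : ℝ), ρ x ≤ t ↔ x ≤ t • e := by
  have smul_iff : ∀ r t : ℝ, r • e ≤ t • e ↔ r ≤ t := fun r t =>
    ⟨fun h => by
      by_contra! hlt
      rw [← sub_nonneg, ← sub_smul] at h
      have h' := smul_nonneg (sub_nonneg.2 hlt.le) he
      rw [← neg_sub, neg_smul, neg_nonneg] at h'
      exact (smul_eq_zero.1 (le_antisymm h' h)).elim (fun h => by linarith) hne,
      fun h => smul_le_smul_of_nonneg_right h he⟩
  have key : ∀ x : V, ∃ c : ℝ, ∀ t : ℝ, c ≤ t ↔ x ≤ t • e := fun x => by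
    obtain ⟨r, hr⟩ := hunit x
    obtain ⟨s, hs⟩ := hunit (-x)
    have bdd : BddBelow {t : ℝ | x ≤ t • e} := ⟨-s, fun t ht => by
      rw [← smul_iff, neg_smul]
      exact (neg_le.1 hs).trans ht⟩
    refine ⟨sInf {t : ℝ | x ≤ t • e}, fun t => ⟨fun h => ?_, fun h => csInf_le bdd h⟩⟩
    refine le_smul_of_forall_pos fun ε hε => ?_
    obtain ⟨u, hu, hut⟩ := exists_lt_of_csInf_lt ⟨r, hr⟩ (h.trans_lt (lt_add_of_pos_right t hε))
    exact le_trans hu ((smul_iff _ _).2 hut.le)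
  choose ρ hρ using key
  have self : ∀ x, x ≤ ρ x • e := fun x => (hρ x _).1 le_rfl
  refine ⟨ρ, ⟨fun x y => ?_, fun r x hr => ?_, fun x y h => ?_, fun x y => ?_, fun r => ?_⟩, hρ⟩
  · rw [hρ, add_smul]
    exact add_le_add (self x) (self y)
  · rw [hρ, mul_smul]
    exact smul_le_smul_of_nonneg_left (self x) hr.le
  · rw [hρ]
    exact h.trans (self y)
  · rw [hρ, sup_smul_of_nonneg he]
    exact sup_le_sup (self x) (self y)
  · refine eq_of_forall_ge_iff fun t => ?_
    rw [hρ, smul_iff]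

/-- The characters of an Archimedean vector lattice with a strong unit detect its order. -/
theorem nonpos_of_forall_character (he : 0 ≤ e) (hunit : ∀ x : V, ∃ r : ℝ, x ≤ r • e) {a : V}
    (h : ∀ φ ∈ latticeCharacters e, φ a ≤ 0) : a ≤ 0 := by
  rcases eq_or_ne e 0 with rfl | hne
  · obtain ⟨r, hr⟩ := hunit a
    rwa [smul_zero] at hr
  obtain ⟨ρ, hρ, hρe⟩ := exists_isSupSublinear he hunit hne
  by_contra hcon
  have hpos : 0 < ρ a := by
    rw [← not_le, hρe, zero_smul]
    exact hcon
  -- A character under the localisation at the maximum of `a` has `φ z ≥ 0`, so `φ a ≥ ρ a > 0`,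
  -- against the hypothesis.
  set z := (a - ρ a • e) ⊓ 0 with hz
  obtain ⟨σ, hσ, hσz, -⟩ := hρ.localize hunit (inf_le_right : z ≤ 0) (hρ.map_sub_unit_inf a)
  obtain ⟨φ, hφ, hφσ⟩ := hσ.exists_character_le hunit
  obtain ⟨hadd, hsmul, hsup, hone⟩ := hφ
  have h0 : φ 0 = 0 := by simpa using hsmul 0 0
  have hmono : ∀ x y, x ≤ y → φ x ≤ φ y := fun x y hxy => by
    have := hsup x y
    rw [sup_eq_right.2 hxy] at this
    rw [this]
    exact le_sup_left
  have h1 : φ (-z) ≤ 0 := by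
    refine (hφσ _).trans ((hσz _).trans ?_)
    rw [neg_add_cancel, hρ.map_zero]
  have h2 := hadd (-z) z
  rw [neg_add_cancel, h0] at h2
  have h3 : φ (ρ a • e + z) ≤ φ a := hmono _ _ (by
    rw [← le_sub_iff_add_le']
    exact inf_le_left)
  rw [hadd, hsmul, hone] at h3
  linarith [h φ ⟨hadd, hsmul, hsup, hone⟩]

end Character

/-! ### The topology of the character space -/

section CharacterSpace

variable {V : Type*} [AddCommGroup V] [Lattice V] [Module ℝ V] {e : V}

namespace latticeCharacters

variable {φ : V → ℝ} (hφ : φ ∈ latticeCharacters e)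
include hφ

theorem map_add (x y : V) : φ (x + y) = φ x + φ y := hφ.1 x y

theorem map_smul (r : ℝ) (x : V) : φ (r • x) = r * φ x := hφ.2.1 r x

theorem map_sup (x y : V) : φ (x ⊔ y) = φ x ⊔ φ y := hφ.2.2.1 x y

theorem map_unit : φ e = 1 := hφ.2.2.2

theorem map_zero : φ 0 = 0 := by simpa using map_smul hφ 0 0

theorem map_neg (x : V) : φ (-x) = -φ x := by simpa using map_smul hφ (-1) x

theorem map_sub (x y : V) : φ (x - y) = φ x - φ y := by
  rw [sub_eq_add_neg, map_add hφ, map_neg hφ, sub_eq_add_neg]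

theorem mono {x y : V} (h : x ≤ y) : φ x ≤ φ y := by
  have := map_sup hφ x y
  rw [sup_eq_right.2 h] at this
  rw [this]
  exact le_sup_left

theorem map_inf [IsOrderedAddMonoid V] (x y : V) : φ (x ⊓ y) = φ x ⊓ φ y := by
  have h : x ⊓ y = -(-x ⊔ -y) := by rw [neg_sup, neg_neg, neg_neg]
  rw [h, map_neg hφ, map_sup hφ, map_neg hφ, map_neg hφ, neg_sup, neg_neg, neg_neg]

theorem map_abs (x : V) : φ |x| = |φ x| := by
  rw [abs, abs, map_sup hφ, map_neg hφ]

end latticeCharacters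

theorem isClosed_latticeCharacters : IsClosed (latticeCharacters e) := by
  simp only [latticeCharacters, Set.ofPred_and, Set.ofPred_forall]
  refine IsClosed.inter ?_ (IsClosed.inter ?_ (IsClosed.inter ?_ ?_))
  · exact isClosed_iInter fun x => isClosed_iInter fun y => isClosed_eq (by fun_prop) (by fun_prop)
  · exact isClosed_iInter fun x => isClosed_iInter fun y => isClosed_eq (by fun_prop) (by fun_prop)
  · exact isClosed_iInter fun x => isClosed_iInter fun y =>
      isClosed_eq (by fun_prop) ((continuous_apply x).sup (continuous_apply y))
  · exact isClosed_eq (by fun_prop) (by fun_prop)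

/-- The strong unit confines each value `φ x` to a fixed interval, so Tychonoff's theorem applies to
this closed set. -/
theorem isCompact_latticeCharacters (hunit : ∀ x : V, ∃ r : ℝ, x ≤ r • e) :
    IsCompact (latticeCharacters e) := by
  choose r hr using hunit
  refine (isCompact_univ_pi fun x => isCompact_Icc (a := -r (-x)) (b := r x)).of_isClosed_subset
    isClosed_latticeCharacters fun φ hφ x _ => ?_
  have key : ∀ x, φ x ≤ r x := fun x => by
    have := latticeCharacters.mono hφ (hr x)
    rwa [latticeCharacters.map_smul hφ, latticeCharacters.map_unit hφ, mul_one] at this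
  refine ⟨?_, key x⟩
  have := key (-x)
  rw [latticeCharacters.map_neg hφ] at this
  linarith

/-- The sets `{t | 0 < t h}` form a neighbourhood base of the character space. -/
theorem exists_pos_subset_of_mem_nhds [IsOrderedAddMonoid V] {s : latticeCharacters e}
    {U : Set (latticeCharacters e)} (hU : U ∈ 𝓝 s) :
    ∃ h : V, 0 < s.1 h ∧ ∀ t : latticeCharacters e, 0 < t.1 h → t ∈ U := by
  classical
  rw [nhds_subtype_eq_comap, nhds_pi] at hU
  obtain ⟨W, hW, hWU⟩ := hU
  obtain ⟨I, T, hT, hTW⟩ := Filter.mem_pi'.1 hW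
  suffices h : ∀ I : Finset V, ∃ h : V, 0 < s.1 h ∧
      ∀ t : latticeCharacters e, 0 < t.1 h → ∀ i ∈ I, t.1 i ∈ T i by
    obtain ⟨h, hs, ht⟩ := h I
    exact ⟨h, hs, fun t h' => hWU (hTW fun i hi => ht t h' i hi)⟩
  intro I
  induction I using Finset.induction_on with
  | empty => exact ⟨e, by rw [latticeCharacters.map_unit s.2]; exact one_pos, by simp⟩
  | insert v I _ ih =>
    obtain ⟨h, hs, ht⟩ := ih
    obtain ⟨ε, hε, hball⟩ := Metric.mem_nhds_iff.1 (hT v)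
    -- The element `ε • e - |v - s v • e|` is a tent around `s`, positive exactly where `t v` is
    -- within `ε` of `s v`. Infima of tents handle finitely many coordinates.
    have hval : ∀ t : latticeCharacters e,
        t.1 (ε • e - |v - s.1 v • e|) = ε - |t.1 v - s.1 v| := fun t => by
      rw [latticeCharacters.map_sub t.2, latticeCharacters.map_smul t.2,
        latticeCharacters.map_abs t.2, latticeCharacters.map_sub t.2,
        latticeCharacters.map_smul t.2, latticeCharacters.map_unit t.2, mul_one, mul_one]
    refine ⟨h ⊓ (ε • e - |v - s.1 v • e|), ?_, fun t ht' i hi => ?_⟩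
    · rw [latticeCharacters.map_inf s.2, hval, sub_self, abs_zero, sub_zero]
      exact lt_inf_iff.2 ⟨hs, hε⟩
    · rw [latticeCharacters.map_inf t.2, hval, lt_inf_iff, sub_pos] at ht'
      rcases Finset.mem_insert.1 hi with rfl | hi
      · exact hball (by rw [Metric.mem_ball, Real.dist_eq]; exact ht'.2)
      · exact ht t ht'.1 i hi

end CharacterSpace

/-! ### Principal ideals -/

section PrincipalIdeal

variable {E : Type*} [AddCommGroup E] [Lattice E] [IsOrderedAddMonoid E] [Module ℝ E]
  [IsOrderedModule ℝ E]

/-- The ideal generated by a positive element. -/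
def principalIdeal (e : E) : Submodule ℝ E where
  carrier := {x | ∃ r : ℝ, |x| ≤ r • e}
  zero_mem' := ⟨0, by simp⟩
  add_mem' := by
    rintro x y ⟨r, hr⟩ ⟨s, hs⟩
    exact ⟨r + s, (abs_add_le x y).trans ((add_le_add hr hs).trans_eq (add_smul r s e).symm)⟩
  smul_mem' := by
    rintro c x ⟨r, hr⟩
    refine ⟨|c| * r, ?_⟩
    rw [abs_real_smul, mul_smul]
    exact smul_le_smul_of_nonneg_left hr (abs_nonneg c)

theorem sup_mem_principalIdeal {e x y : E} (hx : x ∈ principalIdeal e)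
    (hy : y ∈ principalIdeal e) : x ⊔ y ∈ principalIdeal e := by
  obtain ⟨r, hr⟩ := hx
  obtain ⟨s, hs⟩ := hy
  exact ⟨r + s, (abs_sup_le_add x y).trans ((add_le_add hr hs).trans_eq (add_smul r s e).symm)⟩

theorem inf_mem_principalIdeal {e x y : E} (hx : x ∈ principalIdeal e)
    (hy : y ∈ principalIdeal e) : x ⊓ y ∈ principalIdeal e := by
  have h : x ⊓ y = -(-x ⊔ -y) := by rw [neg_sup, neg_neg, neg_neg]
  rw [h]
  exact neg_mem (sup_mem_principalIdeal (neg_mem hx) (neg_mem hy))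

instance (e : E) : Lattice (principalIdeal e) :=
  Subtype.lattice (fun _ _ => sup_mem_principalIdeal) (fun _ _ => inf_mem_principalIdeal)

instance (e : E) : IsOrderedAddMonoid (principalIdeal e) where
  add_le_add_left _ _ h z := add_le_add_left (α := E) h z.1

instance (e : E) : IsOrderedModule ℝ (principalIdeal e) :=
  have : PosSMulMono ℝ (principalIdeal e) :=
    ⟨fun r hr u v h => show r • u.1 ≤ r • v.1 from
      smul_le_smul_of_nonneg_left (show u.1 ≤ v.1 from h) hr⟩
  IsOrderedModule.of_smul_nonneg fun r hr a ha => show (0 : E) ≤ r • a.1 from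
    smul_nonneg hr (show (0 : E) ≤ a.1 from ha)

instance (e : E) [ArchimedeanVectorLattice E] : ArchimedeanVectorLattice (principalIdeal e) where
  le_zero_of_forall_nsmul_le x y h :=
    ArchimedeanVectorLattice.le_zero_of_forall_nsmul_le x.1 y.1 h

variable {e : E} (he : 0 ≤ e)

/-- The generator as an element of its principal ideal. -/
def idealUnit : principalIdeal e := ⟨e, 1, by rw [abs_of_nonneg he, one_smul]⟩

theorem idealUnit_nonneg : 0 ≤ idealUnit he := he

theorem exists_le_smul_idealUnit (x : principalIdeal e) : ∃ r : ℝ, x ≤ r • idealUnit he := by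
  obtain ⟨r, hr⟩ := x.2
  exact ⟨r, (le_abs_self x.1).trans hr⟩

/-- The truncation `|x| ⊓ r e`. -/
def truncation (x : E) {r : ℝ} (hr : 0 ≤ r) : principalIdeal e :=
  ⟨|x| ⊓ r • e, r, by
    rw [abs_of_nonneg (le_inf (abs_nonneg x) (smul_nonneg hr he))]
    exact inf_le_right⟩

/-- The truncation `|x| ⊓ e`. -/
def unitTruncation (x : E) : principalIdeal e :=
  ⟨|x| ⊓ e, 1, by
    rw [abs_of_nonneg (le_inf (abs_nonneg x) he), one_smul]
    exact inf_le_right⟩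

theorem unitTruncation_nonneg (x : E) : 0 ≤ unitTruncation he x :=
  show (0 : E) ≤ |x| ⊓ e from le_inf (abs_nonneg x) he

theorem unitTruncation_mono {x y : E} (h : |x| ≤ |y|) : unitTruncation he x ≤ unitTruncation he y :=
  show |x| ⊓ e ≤ |y| ⊓ e from inf_le_inf_right e h

theorem unitTruncation_add_le (x y : E) :
    unitTruncation he (x + y) ≤ unitTruncation he x + unitTruncation he y :=
  show |x + y| ⊓ e ≤ |x| ⊓ e + |y| ⊓ e from
    (inf_le_inf_right e (abs_add_le x y)).trans
      (add_inf_le_inf_add_inf (abs_nonneg x) (abs_nonneg y) he)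

/-- The summand `1` in the factor keeps the multiple of `e` on the right at least `e`, even when
`|r| < 1`. -/
theorem unitTruncation_smul_le (r : ℝ) (x : E) :
    unitTruncation he (r • x) ≤ (|r| + 1) • unitTruncation he x := by
  change |r • x| ⊓ e ≤ (|r| + 1) • (|x| ⊓ e)
  have hr := abs_nonneg r
  rw [abs_real_smul, smul_inf_of_nonneg (by positivity), add_smul, add_smul, one_smul, one_smul]
  exact inf_le_inf (le_add_of_nonneg_right (abs_nonneg x))
    (le_add_of_nonneg_left (smul_nonneg hr he))

/-- The character `φ` of the principal ideal of `e`, extended to the ambient vector lattice, takes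
the finite value `c` at `x`. -/
def HasCharacterValue (φ : principalIdeal e → ℝ) (x : E) (c : ℝ) : Prop :=
  φ (unitTruncation he (x - c • e)) = 0

variable {he} {φ : principalIdeal e → ℝ} (hφ : φ ∈ latticeCharacters (idealUnit he))
include hφ

/-- With the two lemmas that follow, this shows that the elements whose truncation `φ` kills form an
order ideal of `E`. Having the value `c` means being congruent to `c • e` modulo this ideal, so
values respect the lattice operations. -/
theorem unitTruncation_null_of_le {x y : E} (h : |x| ≤ |y|) (hy : φ (unitTruncation he y) = 0) :
    φ (unitTruncation he x) = 0 := by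
  refine le_antisymm ((latticeCharacters.mono hφ (unitTruncation_mono he h)).trans_eq hy) ?_
  exact (latticeCharacters.map_zero hφ).ge.trans
    (latticeCharacters.mono hφ (unitTruncation_nonneg he x))

theorem unitTruncation_null_add {x y : E} (hx : φ (unitTruncation he x) = 0)
    (hy : φ (unitTruncation he y) = 0) : φ (unitTruncation he (x + y)) = 0 := by
  refine le_antisymm ((latticeCharacters.mono hφ (unitTruncation_add_le he x y)).trans_eq ?_) ?_
  · rw [latticeCharacters.map_add hφ, hx, hy, add_zero]
  · exact (latticeCharacters.map_zero hφ).ge.trans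
      (latticeCharacters.mono hφ (unitTruncation_nonneg he _))

theorem unitTruncation_null_smul (r : ℝ) {x : E} (hx : φ (unitTruncation he x) = 0) :
    φ (unitTruncation he (r • x)) = 0 := by
  refine le_antisymm ((latticeCharacters.mono hφ (unitTruncation_smul_le he r x)).trans_eq ?_) ?_
  · rw [latticeCharacters.map_smul hφ, hx, mul_zero]
  · exact (latticeCharacters.map_zero hφ).ge.trans
      (latticeCharacters.mono hφ (unitTruncation_nonneg he _))

namespace HasCharacterValue

theorem add {x y : E} {a b : ℝ} (hx : HasCharacterValue he φ x a)
    (hy : HasCharacterValue he φ y b) : HasCharacterValue he φ (x + y) (a + b) := by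
  have := unitTruncation_null_add hφ hx hy
  rwa [← add_sub_add_comm, ← add_smul] at this

theorem smul (r : ℝ) {x : E} {a : ℝ} (hx : HasCharacterValue he φ x a) :
    HasCharacterValue he φ (r • x) (r * a) := by
  have := unitTruncation_null_smul hφ r hx
  rwa [smul_sub, smul_smul] at this

theorem sup {x y : E} {a b : ℝ} (hx : HasCharacterValue he φ x a)
    (hy : HasCharacterValue he φ y b) : HasCharacterValue he φ (x ⊔ y) (a ⊔ b) := by
  have hx' := unitTruncation_null_of_le hφ (abs_abs _).le hx
  have hy' := unitTruncation_null_of_le hφ (abs_abs _).le hy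
  refine unitTruncation_null_of_le hφ ?_ (unitTruncation_null_add hφ hx' hy')
  rw [sup_smul_of_nonneg he]
  exact (abs_sup_sub_sup_le _ _ _ _).trans (le_abs_self _)

theorem of_mem (x : principalIdeal e) : HasCharacterValue he φ x.1 (φ x) := by
  have h : unitTruncation he (x.1 - φ x • e) = |x - φ x • idealUnit he| ⊓ idealUnit he := rfl
  rw [HasCharacterValue, h, latticeCharacters.map_inf hφ, latticeCharacters.map_abs hφ,
    latticeCharacters.map_sub hφ, latticeCharacters.map_smul hφ, latticeCharacters.map_unit hφ]
  simp

/-- The difference `(a - b) • e` is null, while its truncation has value `min |a - b| 1`. -/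
theorem unique {x : E} {a b : ℝ} (ha : HasCharacterValue he φ x a)
    (hb : HasCharacterValue he φ x b) : a = b := by
  have h := (ha.add hφ (hb.smul hφ (-1)))
  rw [neg_one_smul, add_neg_cancel, HasCharacterValue, zero_sub] at h
  have h' : unitTruncation he (-((a + -1 * b) • e)) =
      |-((a + -1 * b) • idealUnit he)| ⊓ idealUnit he := rfl
  rw [h', latticeCharacters.map_inf hφ, latticeCharacters.map_abs hφ, latticeCharacters.map_neg hφ,
    latticeCharacters.map_smul hφ, latticeCharacters.map_unit hφ, mul_one, abs_neg] at h
  rcases min_choice |a + -1 * b| 1 with h1 | h1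
  · rw [h1, abs_eq_zero] at h
    linarith
  · rw [h1] at h
    exact absurd h one_ne_zero

theorem nonneg {x : E} {a : ℝ} (hx : 0 ≤ x) (ha : HasCharacterValue he φ x a) : 0 ≤ a := by
  have h0 : HasCharacterValue he φ 0 0 := by simpa using ha.smul hφ 0
  have h := ha.sup hφ h0
  rw [sup_eq_left.2 hx] at h
  rw [ha.unique hφ h]
  exact le_sup_right

/-- With `y = x ⊓ r • e`, the elements `x - y` and `r • e - y` are disjoint. As `φ` is positive on
the second, it kills the truncation of the first, so `x` and `y` have the same value. -/
theorem of_truncation_lt {x : E} (hx : 0 ≤ x) {r : ℝ} (hr : 0 ≤ r)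
    (h : φ (truncation he x hr) < r) : HasCharacterValue he φ x (φ (truncation he x hr)) := by
  set y := truncation he x hr with hy
  have hyE : (y : E) = x ⊓ r • e := by
    change |x| ⊓ r • e = x ⊓ r • e
    rw [abs_of_nonneg hx]
  have hle : unitTruncation he (x - y) ⊓ (r • idealUnit he - y) ≤ 0 := by
    change (|x - (y : E)| ⊓ e) ⊓ (r • e - (y : E)) ≤ 0
    have hxy : (y : E) ≤ x := by rw [hyE]; exact inf_le_left
    rw [abs_of_nonneg (sub_nonneg.2 hxy)]
    refine (inf_le_inf_right _ inf_le_left).trans ?_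
    rw [sub_eq_add_neg, sub_eq_add_neg, ← inf_add, ← hyE, add_neg_cancel]
  have hnull : φ (unitTruncation he (x - y)) = 0 := by
    have h1 := latticeCharacters.mono hφ hle
    have h2 := (latticeCharacters.map_zero hφ).ge.trans
      (latticeCharacters.mono hφ (unitTruncation_nonneg he (x - y)))
    rw [latticeCharacters.map_inf hφ, latticeCharacters.map_zero hφ, latticeCharacters.map_sub hφ,
      latticeCharacters.map_smul hφ, latticeCharacters.map_unit hφ, mul_one, inf_le_iff] at h1
    rcases h1 with h1 | h1
    · exact le_antisymm h1 h2
    · linarith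
  have := unitTruncation_null_add hφ hnull (of_mem hφ y)
  rwa [sub_add_sub_cancel] at this

end HasCharacterValue

omit hφ

variable [ArchimedeanVectorLattice E]

variable (he) in
-- The characters that are infinite at `x` lie in a closed set `A`. An interior point of `A` would
-- give a nonzero `k ≥ 0` supported in `A` with `n • k ≤ x` for all `n`, which the Archimedean
-- property forbids; so `A` is nowhere dense.
theorem residual_hasCharacterValue_of_nonneg {x : E} (hx : 0 ≤ x) :
    ∀ᶠ s : latticeCharacters (idealUnit he) in residual _, ∃ c, HasCharacterValue he s.1 x c := by
  set A : Set (latticeCharacters (idealUnit he)) :=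
    {s | ∀ n : ℕ, (n : ℝ) ≤ s.1 (truncation he x n.cast_nonneg)} with hA
  have hclosed : IsClosed A := by
    rw [hA, Set.ofPred_forall]
    exact isClosed_iInter fun n =>
      isClosed_le continuous_const ((continuous_apply _).comp continuous_subtype_val)
  have hint : interior A = ∅ := by
    by_contra hne
    obtain ⟨s, hs⟩ := Set.nonempty_iff_ne_empty.2 hne
    obtain ⟨h, hsh, hU⟩ := exists_pos_subset_of_mem_nhds (mem_interior_iff_mem_nhds.1 hs)
    -- Capping at the unit gives `k ≤ 1` on `A`, where `x ⊓ n • e` is at least `n`; off `A`, `k`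
    -- vanishes. This is `n • k ≤ x ⊓ n • e`, tested on characters.
    set k : principalIdeal e := (h ⊔ 0) ⊓ idealUnit he with hk
    have hval : ∀ t : latticeCharacters (idealUnit he), t.1 k = (t.1 h ⊔ 0) ⊓ 1 := fun t => by
      rw [hk, latticeCharacters.map_inf t.2, latticeCharacters.map_sup t.2,
        latticeCharacters.map_zero t.2, latticeCharacters.map_unit t.2]
    have hle : ∀ n : ℕ, (n : ℝ) • k ≤ truncation he x n.cast_nonneg := fun n => by
      rw [← sub_nonpos]
      refine nonpos_of_forall_character (idealUnit_nonneg he) (exists_le_smul_idealUnit he)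
        fun φ hφ => ?_
      rw [latticeCharacters.map_sub hφ, latticeCharacters.map_smul hφ,
        show φ k = _ from hval ⟨φ, hφ⟩, sub_nonpos]
      rcases le_or_gt (φ h) 0 with hn | hp
      · have h0 : (0 : principalIdeal e) ≤ truncation he x n.cast_nonneg :=
          show (0 : E) ≤ |x| ⊓ (n : ℝ) • e from
            le_inf (abs_nonneg x) (smul_nonneg n.cast_nonneg he)
        rw [sup_eq_right.2 hn, inf_eq_left.2 zero_le_one, mul_zero]
        exact (latticeCharacters.map_zero hφ).ge.trans (latticeCharacters.mono hφ h0)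
      · exact (mul_le_of_le_one_right n.cast_nonneg inf_le_right).trans (hU ⟨φ, hφ⟩ hp n)
    have hk0 : (k : E) ≤ 0 := by
      refine ArchimedeanVectorLattice.le_zero_of_forall_nsmul_le _ x fun n => ?_
      rw [← Nat.cast_smul_eq_nsmul ℝ]
      refine le_trans (show ((n : ℝ) • (k : E)) ≤ |x| ⊓ (n : ℝ) • e from hle n) ?_
      rw [abs_of_nonneg hx]
      exact inf_le_left
    have h1 := latticeCharacters.mono s.2 (show k ≤ 0 from hk0)
    rw [hval, latticeCharacters.map_zero s.2] at h1
    exact absurd h1 (not_le.2 (lt_inf_iff.2 ⟨lt_sup_of_lt_left hsh, one_pos⟩))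
  refine Filter.mem_of_superset (residual_of_dense_open hclosed.isOpen_compl
    (interior_eq_empty_iff_dense_compl.1 hint)) fun s hs => ?_
  simp only [hA, Set.mem_compl_iff, Set.mem_ofPred_eq, not_forall, not_le] at hs
  obtain ⟨n, hn⟩ := hs
  exact ⟨_, HasCharacterValue.of_truncation_lt s.2 hx n.cast_nonneg hn⟩

variable (he) in
/-- Every element has a finite value at all characters outside a meagre set. -/
theorem residual_hasCharacterValue (x : E) :
    ∀ᶠ s : latticeCharacters (idealUnit he) in residual _, ∃ c, HasCharacterValue he s.1 x c := by
  filter_upwards [residual_hasCharacterValue_of_nonneg he (posPart_nonneg x),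
    residual_hasCharacterValue_of_nonneg he (negPart_nonneg x)] with s ⟨a, ha⟩ ⟨b, hb⟩
  have := ha.add s.2 (hb.smul s.2 (-1))
  rw [neg_one_smul, ← sub_eq_add_neg, posPart_sub_negPart] at this
  exact ⟨_, this⟩

/-- The value of an extended character, with value `0` where it is not finite. -/
noncomputable def characterValue (he : 0 ≤ e) (φ : principalIdeal e → ℝ) (x : E) : ℝ :=
  open Classical in if h : ∃ c, HasCharacterValue he φ x c then h.choose else 0

theorem HasCharacterValue.characterValue_eq {φ : principalIdeal e → ℝ}
    (hφ : φ ∈ latticeCharacters (idealUnit he)) {x : E} {c : ℝ} (h : HasCharacterValue he φ x c) :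
    characterValue he φ x = c := by
  have h' : ∃ c, HasCharacterValue he φ x c := ⟨c, h⟩
  rw [characterValue, dif_pos h']
  exact h'.choose_spec.unique hφ h

end PrincipalIdeal

/-! ### Germs along a filter with the countable intersection property -/

section Germ

variable {α : Type*} (l : Filter α)

instance germ_isOrderedModule : IsOrderedModule ℝ (l.Germ ℝ) :=
  have : PosSMulMono ℝ (l.Germ ℝ) := ⟨fun r hr u v h => by
    induction u using Filter.Germ.inductionOn with | _ u
    induction v using Filter.Germ.inductionOn with | _ v
    rw [← Filter.Germ.coe_smul, ← Filter.Germ.coe_smul, Filter.Germ.coe_le]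
    filter_upwards [Filter.Germ.coe_le.1 h] with x hx
    exact mul_le_mul_of_nonneg_left hx hr⟩
  IsOrderedModule.of_smul_nonneg fun _ hr _ ha => smul_nonneg hr ha

/-- The inequalities for all `n` hold simultaneously on one set of the filter, and `ℝ` is
Archimedean pointwise. -/
theorem germ_archimedean [CountableInterFilter l] : ArchimedeanVectorLattice (l.Germ ℝ) where
  le_zero_of_forall_nsmul_le u v h := by
    induction u using Filter.Germ.inductionOn with | _ u
    induction v using Filter.Germ.inductionOn with | _ v
    have h' : ∀ n : ℕ, ∀ᶠ x in l, n • u x ≤ v x := fun n => Filter.Germ.coe_le.1 (h n)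
    refine Filter.Germ.coe_le.2 ?_
    filter_upwards [eventually_countable_forall.2 h'] with x hx
    change u x ≤ 0
    by_contra! hpos
    obtain ⟨n, hn⟩ := Archimedean.arch (v x + 1) hpos
    linarith [hx n]

end Germ

/-! ### The bimorphism into germs on pairs of characters -/

section GermBimorphism

variable {E F : Type*}
  [AddCommGroup E] [Lattice E] [IsOrderedAddMonoid E] [Module ℝ E] [IsOrderedModule ℝ E]
  [ArchimedeanVectorLattice E]
  [AddCommGroup F] [Lattice F] [IsOrderedAddMonoid F] [Module ℝ F] [IsOrderedModule ℝ F]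
  [ArchimedeanVectorLattice F] {e : E} {d : F} (he : 0 ≤ e) (hd : 0 ≤ d)

/-- Projections are continuous and open, so they pull residual sets back to residual sets. -/
theorem residual_prod_hasCharacterValue_left (x : E) :
    ∀ᶠ s : latticeCharacters (idealUnit he) × latticeCharacters (idealUnit hd) in residual _,
      ∃ c, HasCharacterValue he s.1.1 x c :=
  (tendsto_residual_of_isOpenMap continuous_fst isOpenMap_fst).eventually
    (residual_hasCharacterValue he x)

theorem residual_prod_hasCharacterValue_right (y : F) :
    ∀ᶠ s : latticeCharacters (idealUnit he) × latticeCharacters (idealUnit hd) in residual _,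
      ∃ c, HasCharacterValue hd s.2.1 y c :=
  (tendsto_residual_of_isOpenMap continuous_snd isOpenMap_snd).eventually
    (residual_hasCharacterValue hd y)

/-- The product of two extended characters, as a function of the pair of characters. -/
noncomputable def characterProduct (x : E) (y : F)
    (s : latticeCharacters (idealUnit he) × latticeCharacters (idealUnit hd)) : ℝ :=
  characterValue he s.1.1 x * characterValue hd s.2.1 y

variable {he hd} in
theorem characterProduct_eq {s : latticeCharacters (idealUnit he) × latticeCharacters (idealUnit hd)}
    {x : E} {y : F} {a b : ℝ} (hx : HasCharacterValue he s.1.1 x a)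
    (hy : HasCharacterValue hd s.2.1 y b) : characterProduct he hd x y s = a * b := by
  rw [characterProduct, hx.characterValue_eq s.1.2, hy.characterValue_eq s.2.2]

/-- The product of extended characters, as a germ of functions off a meagre set. -/
noncomputable def characterGerm : E →ₗ[ℝ] F →ₗ[ℝ]
    (residual (latticeCharacters (idealUnit he) × latticeCharacters (idealUnit hd))).Germ ℝ :=
  LinearMap.mk₂ ℝ (fun x y => (characterProduct he hd x y : Filter.Germ _ ℝ))
    (fun x x' y => by
      rw [← Filter.Germ.coe_add, Filter.Germ.coe_eq]
      filter_upwards [residual_prod_hasCharacterValue_left he hd x,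
        residual_prod_hasCharacterValue_left he hd x',
        residual_prod_hasCharacterValue_right he hd y] with s ⟨a, ha⟩ ⟨b, hb⟩ ⟨c, hc⟩
      rw [Pi.add_apply, characterProduct_eq (ha.add s.1.2 hb) hc, characterProduct_eq ha hc,
        characterProduct_eq hb hc, add_mul])
    (fun r x y => by
      rw [← Filter.Germ.coe_smul, Filter.Germ.coe_eq]
      filter_upwards [residual_prod_hasCharacterValue_left he hd x,
        residual_prod_hasCharacterValue_right he hd y] with s ⟨a, ha⟩ ⟨c, hc⟩
      rw [Pi.smul_apply, characterProduct_eq (ha.smul s.1.2 r) hc, characterProduct_eq ha hc,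
        smul_eq_mul, mul_assoc])
    (fun x y y' => by
      rw [← Filter.Germ.coe_add, Filter.Germ.coe_eq]
      filter_upwards [residual_prod_hasCharacterValue_left he hd x,
        residual_prod_hasCharacterValue_right he hd y,
        residual_prod_hasCharacterValue_right he hd y'] with s ⟨c, hc⟩ ⟨a, ha⟩ ⟨b, hb⟩
      rw [Pi.add_apply, characterProduct_eq hc (ha.add s.2.2 hb), characterProduct_eq hc ha,
        characterProduct_eq hc hb, mul_add])
    (fun r x y => by
      rw [← Filter.Germ.coe_smul, Filter.Germ.coe_eq]
      filter_upwards [residual_prod_hasCharacterValue_left he hd x,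
        residual_prod_hasCharacterValue_right he hd y] with s ⟨c, hc⟩ ⟨a, ha⟩
      rw [Pi.smul_apply, characterProduct_eq hc (ha.smul s.2.2 r), characterProduct_eq hc ha,
        smul_eq_mul, mul_left_comm])

theorem characterGerm_apply (x : E) (y : F) :
    characterGerm he hd x y = (characterProduct he hd x y : Filter.Germ _ ℝ) := rfl

theorem isLatticeBimorphism_characterGerm : IsLatticeBimorphism (characterGerm he hd) where
  map_sup_right x y y' hx := by
    refine (Filter.Germ.coe_eq (f := characterProduct he hd x (y ⊔ y'))
      (g := fun s => characterProduct he hd x y s ⊔ characterProduct he hd x y' s)).2 ?_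
    filter_upwards [residual_prod_hasCharacterValue_left he hd x,
      residual_prod_hasCharacterValue_right he hd y,
      residual_prod_hasCharacterValue_right he hd y'] with s ⟨c, hc⟩ ⟨a, ha⟩ ⟨b, hb⟩
    rw [characterProduct_eq hc (ha.sup s.2.2 hb), characterProduct_eq hc ha,
      characterProduct_eq hc hb]
    exact mul_max_of_nonneg a b (hc.nonneg s.1.2 hx)
  map_sup_left x x' y hy := by
    refine (Filter.Germ.coe_eq (f := characterProduct he hd (x ⊔ x') y)
      (g := fun s => characterProduct he hd x y s ⊔ characterProduct he hd x' y s)).2 ?_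
    filter_upwards [residual_prod_hasCharacterValue_right he hd y,
      residual_prod_hasCharacterValue_left he hd x,
      residual_prod_hasCharacterValue_left he hd x'] with s ⟨c, hc⟩ ⟨a, ha⟩ ⟨b, hb⟩
    rw [characterProduct_eq (ha.sup s.1.2 hb) hc, characterProduct_eq ha hc,
      characterProduct_eq hb hc]
    exact max_mul_of_nonneg a b (hc.nonneg s.2.2 hy)

/-- A finite sum of elementary tensors that is positive in the Fremlin tensor product is positive
under all pairs of characters of principal ideals containing the factors. -/
theorem sum_characters_nonneg {ι : Type*} (S : Finset ι) (x : ι → principalIdeal e)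
    (y : ι → principalIdeal d) (h : 0 ≤ ∑ i ∈ S, FremlinTensor.tmul E F (x i) (y i))
    {φ : principalIdeal e → ℝ} (hφ : φ ∈ latticeCharacters (idealUnit he))
    {ψ : principalIdeal d → ℝ} (hψ : ψ ∈ latticeCharacters (idealUnit hd)) :
    0 ≤ ∑ i ∈ S, φ (x i) * ψ (y i) := by
  have : CompactSpace (latticeCharacters (idealUnit he)) :=
    isCompact_iff_compactSpace.1 (isCompact_latticeCharacters (exists_le_smul_idealUnit he))
  have : CompactSpace (latticeCharacters (idealUnit hd)) :=
    isCompact_iff_compactSpace.1 (isCompact_latticeCharacters (exists_le_smul_idealUnit hd))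
  have := germ_archimedean
    (residual (latticeCharacters (idealUnit he) × latticeCharacters (idealUnit hd)))
  obtain ⟨T, ⟨⟨hT, -⟩, hTmul⟩, -⟩ :=
    FremlinTensor.existsUnique_lift _ (isLatticeBimorphism_characterGerm he hd)
  have hpos : 0 ≤ T (∑ i ∈ S, FremlinTensor.tmul E F (x i) (y i)) := by
    have := hT 0 (∑ i ∈ S, FremlinTensor.tmul E F (x i) (y i))
    rw [sup_eq_right.2 h, map_zero] at this
    rw [this]
    exact le_sup_left
  have hsum : T (∑ i ∈ S, FremlinTensor.tmul E F (x i) (y i)) =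
      ((∑ i ∈ S, characterProduct he hd (x i) (y i) : _ → ℝ) : Filter.Germ _ ℝ) := by
    simp only [map_sum, hTmul, characterGerm_apply]
    exact (map_sum (Filter.Germ.coeAddHom (residual (latticeCharacters (idealUnit he) ×
      latticeCharacters (idealUnit hd))) : (_ → ℝ) →+ _)
      (fun i => characterProduct he hd (x i) (y i)) S).symm
  rw [hsum] at hpos
  have hev : ∀ᶠ s : latticeCharacters (idealUnit he) × latticeCharacters (idealUnit hd) in
      residual _, 0 ≤ ∑ i ∈ S, s.1.1 (x i) * s.2.1 (y i) := by
    filter_upwards [Filter.Germ.coe_le.1 hpos] with s hs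
    refine le_of_le_of_eq hs ?_
    rw [Finset.sum_apply]
    exact Finset.sum_congr rfl fun i _ =>
      characterProduct_eq (.of_mem s.1.2 (x i)) (.of_mem s.2.2 (y i))
  have hclosed : IsClosed {s : latticeCharacters (idealUnit he) × latticeCharacters (idealUnit hd) |
      0 ≤ ∑ i ∈ S, s.1.1 (x i) * s.2.1 (y i)} := by
    refine isClosed_le continuous_const (continuous_finsetSum S fun i _ => ?_)
    exact ((continuous_apply (x i)).comp (continuous_subtype_val.comp continuous_fst)).mul
      ((continuous_apply (y i)).comp (continuous_subtype_val.comp continuous_snd))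
  -- The product of the compact Hausdorff character spaces is a Baire space, so the residual set is
  -- dense.
  have huniv := (dense_of_mem_residual hev).closure_eq
  rw [hclosed.closure_eq] at huniv
  exact huniv.ge (Set.mem_univ (⟨φ, hφ⟩, ⟨ψ, hψ⟩))

end GermBimorphism

/-! ### Products of positive functionals -/

section PositiveFunctional

open TensorProduct

variable {E F : Type*}
  [AddCommGroup E] [Lattice E] [IsOrderedAddMonoid E] [Module ℝ E] [IsOrderedModule ℝ E]
  [AddCommGroup F] [Lattice F] [IsOrderedAddMonoid F] [Module ℝ F] [IsOrderedModule ℝ F]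

theorem latticeCharacters.map_sum_smul {e : E} {φ : E → ℝ} (hφ : φ ∈ latticeCharacters e)
    {ι : Type*} (S : Finset ι) (c : ι → ℝ) (z : ι → E) :
    φ (∑ i ∈ S, c i • z i) = ∑ i ∈ S, c i * φ (z i) := by
  let L : E →ₗ[ℝ] ℝ := ⟨⟨φ, latticeCharacters.map_add hφ⟩, latticeCharacters.map_smul hφ⟩
  have h : L (∑ i ∈ S, c i • z i) = ∑ i ∈ S, c i * L (z i) := by simp
  exact h

theorem nonneg_of_forall_character [ArchimedeanVectorLattice E] {e : E} (he : 0 ≤ e)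
    {a : principalIdeal e} (h : ∀ φ ∈ latticeCharacters (idealUnit he), 0 ≤ φ a) : 0 ≤ (a : E) := by
  refine neg_nonpos.1 (show -a ≤ 0 from ?_)
  refine nonpos_of_forall_character (idealUnit_nonneg he) (exists_le_smul_idealUnit he)
    fun φ hφ => ?_
  rw [latticeCharacters.map_neg hφ]
  exact neg_nonpos.2 (h φ hφ)

theorem mem_principalIdeal_sum_abs {ι : Type*} {S : Finset ι} (x : ι → E) {i : ι} (hi : i ∈ S) :
    x i ∈ principalIdeal (∑ j ∈ S, |x j|) :=
  ⟨1, by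
    rw [one_smul]
    exact Finset.single_le_sum (f := fun j => |x j|) (fun j _ => abs_nonneg (x j)) hi⟩

/-- The product of two positive functionals is positive on the elements of the algebraic tensor
product that are positive in the Fremlin tensor product. -/
theorem lift_nonneg_of_positive [ArchimedeanVectorLattice E] [ArchimedeanVectorLattice F]
    {f : E →ₗ[ℝ] ℝ} (hf : ∀ x, 0 ≤ x → 0 ≤ f x) {g : F →ₗ[ℝ] ℝ} (hg : ∀ y, 0 ≤ y → 0 ≤ g y)
    (w : E ⊗[ℝ] F) (hw : 0 ≤ TensorProduct.lift (FremlinTensor.tmul E F) w) :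
    0 ≤ TensorProduct.lift ((LinearMap.mul ℝ ℝ).compl₁₂ f g) w := by
  obtain ⟨S, rfl⟩ := TensorProduct.exists_finset w
  simp only [map_sum, TensorProduct.lift.tmul, LinearMap.compl₁₂_apply, LinearMap.mul_apply'] at hw ⊢
  -- These units dominate all factors, so every `xᵢ` and `yᵢ` has finite values at all characters.
  set e := ∑ i ∈ S, |i.1|
  set d := ∑ i ∈ S, |i.2|
  have he : 0 ≤ e := Finset.sum_nonneg fun i _ => abs_nonneg i.1
  have hd : 0 ≤ d := Finset.sum_nonneg fun i _ => abs_nonneg i.2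
  let x : S → principalIdeal e := fun i => ⟨i.1.1, mem_principalIdeal_sum_abs Prod.fst i.2⟩
  let y : S → principalIdeal d := fun i => ⟨i.1.2, mem_principalIdeal_sum_abs Prod.snd i.2⟩
  have hw' : 0 ≤ ∑ i : S, FremlinTensor.tmul E F (x i) (y i) := by
    rwa [← Finset.sum_coe_sort S] at hw
  have hswap : ∀ (c : S → ℝ) (z : S → principalIdeal e),
      (∑ i, c i • z i).1 = ∑ i, c i • (z i).1 := fun c z => by simp
  have hswap' : ∀ (c : S → ℝ) (z : S → principalIdeal d),
      (∑ i, c i • z i).1 = ∑ i, c i • (z i).1 := fun c z => by simp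
  have h1 : ∀ ψ ∈ latticeCharacters (idealUnit hd), 0 ≤ ∑ i, ψ (y i) * f (x i) := fun ψ hψ => by
    have := hf _ (nonneg_of_forall_character he (a := ∑ i, ψ (y i) • x i) fun φ hφ => by
      rw [latticeCharacters.map_sum_smul hφ]
      simpa only [mul_comm] using sum_characters_nonneg he hd Finset.univ x y hw' hφ hψ)
    simpa only [hswap, map_sum, _root_.map_smul, smul_eq_mul] using this
  have h2 := hg _ (nonneg_of_forall_character hd (a := ∑ i, f (x i) • y i) fun ψ hψ => by
    rw [latticeCharacters.map_sum_smul hψ]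
    simpa only [mul_comm] using h1 ψ hψ)
  simp only [hswap', map_sum, _root_.map_smul, smul_eq_mul] at h2
  rwa [← Finset.sum_coe_sort S]

end PositiveFunctional

/-! ### The two bounds for the tensor seminorm -/

section TensorSeminormBounds

open TensorProduct

variable {E F : Type*}
  [AddCommGroup E] [Lattice E] [IsOrderedAddMonoid E] [Module ℝ E] [IsOrderedModule ℝ E]
  [AddCommGroup F] [Lattice F] [IsOrderedAddMonoid F] [Module ℝ F] [IsOrderedModule ℝ F]

theorem IsRieszSeminorm.map_abs {p : Seminorm ℝ E} (hp : IsRieszSeminorm p) (x : E) :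
    p |x| = p x :=
  le_antisymm (hp _ _ (abs_abs x).le) (hp _ _ (abs_abs x).ge)

/-- A Riesz seminorm is attained at each element by a positive functional that it dominates. -/
theorem IsRieszSeminorm.exists_positive_functional {p : Seminorm ℝ E} (hp : IsRieszSeminorm p)
    (x : E) : ∃ f : E →ₗ[ℝ] ℝ, (∀ y, 0 ≤ y → 0 ≤ f y) ∧ (∀ y, f |y| ≤ p y) ∧ f |x| = p x := by
  rcases eq_or_ne |x| 0 with hx | hx
  · exact ⟨0, fun _ _ => le_rfl, fun y => apply_nonneg p y, by
      rw [← hp.map_abs x, hx, _root_.map_zero, _root_.map_zero]⟩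
  let φ : E →ₗ.[ℝ] ℝ := LinearPMap.mkSpanSingleton |x| (p x) hx
  have hspan : ∀ z : φ.domain,
      φ z ≤ p ((z : E)⁺) := by
    rintro ⟨z, hz⟩
    obtain ⟨r, rfl⟩ := Submodule.mem_span_singleton.1 hz
    refine (LinearPMap.mkSpanSingleton'_apply _ _ _ r hz).trans_le ?_
    rw [RingHom.id_apply, smul_eq_mul]
    rcases le_total 0 r with hr | hr
    · rw [posPart_of_nonneg (smul_nonneg hr (abs_nonneg x)), map_smul_eq_mul, hp.map_abs,
        Real.norm_of_nonneg hr]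
    · exact (mul_nonpos_of_nonpos_of_nonneg hr (apply_nonneg p x)).trans (apply_nonneg p _)
  -- Majorising by `p z⁺` instead of `p z` forces positivity: for `y ≥ 0`, `f (-y) ≤ p ((-y)⁺) = 0`.
  obtain ⟨f, hfx, hf⟩ := exists_extension_of_le_sublinear φ (fun z => p z⁺)
    (fun r hr z => by
      change p ((r • z) ⊔ 0) = r * p (z ⊔ 0)
      have h := smul_sup_of_nonneg hr.le z 0
      rw [smul_zero] at h
      rw [← h, map_smul_eq_mul, Real.norm_of_nonneg hr.le])
    (fun y z => (hp _ _ (by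
      rw [abs_of_nonneg (posPart_nonneg _),
        abs_of_nonneg (add_nonneg (posPart_nonneg y) (posPart_nonneg z))]
      exact sup_le (add_le_add (le_posPart y) (le_posPart z))
        (add_nonneg (posPart_nonneg y) (posPart_nonneg z)))).trans (map_add_le_add p _ _)) hspan
  refine ⟨f, fun y hy => ?_, fun y => ?_, ?_⟩
  · have := hf (-y)
    rw [posPart_eq_zero.2 (neg_nonpos.2 hy), _root_.map_zero, _root_.map_neg] at this
    linarith
  · have := hf |y|
    rwa [posPart_of_nonneg (abs_nonneg y), hp.map_abs] at this
  · exact (hfx ⟨|x|, Submodule.mem_span_singleton_self |x|⟩).trans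
      (LinearPMap.mkSpanSingleton_apply ℝ ℝ hx (p x))

theorem abs_sub_of_inf_eq_zero {u v : E} (h : u ⊓ v = 0) :
    |u - v| = u + v := by
  rw [← sup_sub_inf_eq_abs_sub, inf_comm, h, sub_zero, ← inf_add_sup u v, h, zero_add, sup_comm]

/-- The tensors `x⁺ ⊗ |y|` and `x⁻ ⊗ |y|` are disjoint because `· ⊗ |y|` is a lattice homomorphism.
Hence the reverse triangle inequality for `x⁺ ⊗ y - x⁻ ⊗ y` has `|x| ⊗ |y|` as its lower bound. -/
theorem tmul_abs_le_abs_tmul (x : E) (y : F) :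
    FremlinTensor.tmul E F |x| |y| ≤ |FremlinTensor.tmul E F x y| := by
  have hright : ∀ x : E, 0 ≤ x → |FremlinTensor.tmul E F x y| = FremlinTensor.tmul E F x |y| :=
    fun x hx => by
      rw [abs, abs, FremlinTensor.isLatticeBimorphism_tmul.map_sup_right x y (-y) hx,
        _root_.map_neg]
  have hdisj : FremlinTensor.tmul E F x⁺ |y| ⊓ FremlinTensor.tmul E F x⁻ |y| = 0 := by
    have h := FremlinTensor.isLatticeBimorphism_tmul.map_sup_left x⁺ x⁻ |y| (abs_nonneg y)
    have h1 := inf_add_sup (FremlinTensor.tmul E F x⁺ |y|) (FremlinTensor.tmul E F x⁻ |y|)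
    rw [← h, ← LinearMap.add_apply, ← _root_.map_add, ← inf_add_sup x⁺ x⁻,
      posPart_inf_negPart_eq_zero, zero_add] at h1
    exact add_eq_right.1 h1
  have h := abs_abs_sub_abs_le (FremlinTensor.tmul E F x⁺ y) (FremlinTensor.tmul E F x⁻ y)
  rw [hright _ (posPart_nonneg x), hright _ (negPart_nonneg x),
    abs_sub_of_inf_eq_zero hdisj,
    ← LinearMap.add_apply, ← LinearMap.sub_apply, ← _root_.map_add, ← _root_.map_sub,
    posPart_add_negPart, posPart_sub_negPart] at h
  exact h

/-- The elements dominated by an algebraic tensor on which a positive functional is at most `1`. -/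
theorem absConvex_dominated (μ : E ⊗[ℝ] F →ₗ[ℝ] ℝ) :
    AbsConvex ℝ {u : FremlinTensor E F | ∃ w : E ⊗[ℝ] F,
      |u| ≤ TensorProduct.lift (FremlinTensor.tmul E F) w ∧ μ w ≤ 1} := by
  refine ⟨balanced_iff_smul_mem.2 ?_, ?_⟩
  · rintro a ha u ⟨w, huw, hw⟩
    rw [Real.norm_eq_abs] at ha
    refine ⟨|a| • w, ?_, ?_⟩
    · rw [abs_real_smul, _root_.map_smul]
      exact smul_le_smul_of_nonneg_left huw (abs_nonneg a)
    · rw [_root_.map_smul, smul_eq_mul]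
      nlinarith [abs_nonneg a]
  · rintro u ⟨w, huw, hw⟩ v ⟨z, hvz, hz⟩ a b ha hb hab
    refine ⟨a • w + b • z, ?_, ?_⟩
    · rw [_root_.map_add, _root_.map_smul, _root_.map_smul]
      refine (abs_add_le _ _).trans (add_le_add ?_ ?_)
      · rw [abs_smul_of_nonneg ha]
        exact smul_le_smul_of_nonneg_left huw ha
      · rw [abs_smul_of_nonneg hb]
        exact smul_le_smul_of_nonneg_left hvz hb
    · rw [_root_.map_add, _root_.map_smul, _root_.map_smul, smul_eq_mul, smul_eq_mul]
      nlinarith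

theorem tensorSeminorm_tmul_le (p : Seminorm ℝ E) (q : Seminorm ℝ F) (x : E) (y : F) :
    tensorSeminorm p q (FremlinTensor.tmul E F x y) ≤ p x * q y := by
  -- The `ε` permits division when `p x` or `q y` is zero.
  have hε : ∀ ε : ℝ, 0 < ε →
      tensorSeminorm p q (FremlinTensor.tmul E F x y) ≤ (p x + ε) * (q y + ε) := fun ε hε => by
    have ha : 0 < p x + ε := by positivity
    have hb : 0 < q y + ε := by positivity
    refine gauge_le_of_mem (by positivity) ⟨FremlinTensor.tmul E F ((p x + ε)⁻¹ • x)
      ((q y + ε)⁻¹ • y), subset_absConvexHull ⟨_, ⟨_, ?_, _, ?_, rfl⟩, le_rfl⟩, ?_⟩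
    · rw [Set.mem_ofPred_eq, map_smul_eq_mul, Real.norm_of_nonneg (by positivity),
        inv_mul_le_iff₀ ha]
      linarith
    · rw [Set.mem_ofPred_eq, map_smul_eq_mul, Real.norm_of_nonneg (by positivity),
        inv_mul_le_iff₀ hb]
      linarith
    · simp only [_root_.map_smul, LinearMap.smul_apply, smul_smul]
      rw [show (p x + ε) * (q y + ε) * ((q y + ε)⁻¹ * (p x + ε)⁻¹) = 1 by field_simp, one_smul]
  have hlim : Filter.Tendsto (fun ε : ℝ => (p x + ε) * (q y + ε)) (𝓝[>] 0) (𝓝 (p x * q y)) := by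
    have hc : Continuous fun ε : ℝ => (p x + ε) * (q y + ε) := by fun_prop
    simpa using (hc.tendsto 0).mono_left nhdsWithin_le_nhds
  exact ge_of_tendsto hlim (Filter.eventually_of_mem self_mem_nhdsWithin hε)

theorem le_tensorSeminorm_tmul [ArchimedeanVectorLattice E] [ArchimedeanVectorLattice F]
    {p : Seminorm ℝ E} (hp : IsRieszSeminorm p) {q : Seminorm ℝ F} (hq : IsRieszSeminorm q)
    (x : E) (y : F) : p x * q y ≤ tensorSeminorm p q (FremlinTensor.tmul E F x y) := by
  obtain ⟨f, hf, hfp, hfx⟩ := hp.exists_positive_functional x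
  obtain ⟨g, hg, hgq, hgy⟩ := hq.exists_positive_functional y
  set μ : E ⊗[ℝ] F →ₗ[ℝ] ℝ := TensorProduct.lift ((LinearMap.mul ℝ ℝ).compl₁₂ f g) with hμ
  have hμ_tmul : ∀ a b, μ (a ⊗ₜ b) = f a * g b := fun a b => by simp [hμ]
  have hball : tensorBall p q ⊆ {u : FremlinTensor E F | ∃ w : E ⊗[ℝ] F,
      |u| ≤ TensorProduct.lift (FremlinTensor.tmul E F) w ∧ μ w ≤ 1} := by
    refine absConvexHull_min ?_ (absConvex_dominated μ)
    rintro u ⟨_, ⟨a, ha, b, hb, rfl⟩, hu⟩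
    refine ⟨|a| ⊗ₜ |b|, ?_, ?_⟩
    · rw [TensorProduct.lift.tmul]
      exact hu.trans (FremlinTensor.abs_tmul_le a b)
    · rw [hμ_tmul]
      exact mul_le_one₀ ((hfp a).trans ha) (hg _ (abs_nonneg b)) ((hgq b).trans hb)
  refine le_of_forall_gt fun r hr => ?_
  obtain ⟨s, hs, hsr, v, hv, hvx⟩ := exists_lt_of_gauge_lt (absorbent_tensorBall p q) hr
  obtain ⟨w, hvw, hw⟩ := hball hv
  have hdom : FremlinTensor.tmul E F |x| |y| ≤
      TensorProduct.lift (FremlinTensor.tmul E F) (s • w) := by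
    refine (tmul_abs_le_abs_tmul x y).trans ?_
    rw [← show s • v = FremlinTensor.tmul E F x y from hvx, abs_smul_of_nonneg hs.le,
      _root_.map_smul]
    exact smul_le_smul_of_nonneg_left hvw hs.le
  -- Positivity of `μ` on this difference reads `p x * q y ≤ s * μ w`, and `μ w ≤ 1`.
  have h := lift_nonneg_of_positive hf hg (s • w - |x| ⊗ₜ |y|) (by
    rw [_root_.map_sub, TensorProduct.lift.tmul]
    exact sub_nonneg.2 hdom)
  rw [← hμ, _root_.map_sub, hμ_tmul, hfx, hgy, _root_.map_smul, smul_eq_mul] at h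
  nlinarith

end TensorSeminormBounds

theorem mainTheorem5 {E F I J : Type*}
    [AddCommGroup E] [Lattice E] [IsOrderedAddMonoid E] [Module ℝ E] [IsOrderedModule ℝ E]
    [ArchimedeanVectorLattice E] [TopologicalSpace E] [LocallyConvexSolid E]
    [AddCommGroup F] [Lattice F] [IsOrderedAddMonoid F] [Module ℝ F] [IsOrderedModule ℝ F]
    [ArchimedeanVectorLattice F] [TopologicalSpace F] [LocallyConvexSolid F]
    (p : SeminormFamily ℝ E I) (hp : WithSeminorms p) (hpR : ∀ α, IsRieszSeminorm (p α))
    (q : SeminormFamily ℝ F J) (hq : WithSeminorms q) (hqR : ∀ β, IsRieszSeminorm (q β))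
    (α : I) (β : J) (x₀ : E) (y₀ : F) :
    tensorSeminorm (p α) (q β) (FremlinTensor.tmul E F x₀ y₀) = p α x₀ * q β y₀ :=
  le_antisymm (tensorSeminorm_tmul_le (p α) (q β) x₀ y₀)
    (le_tensorSeminorm_tmul (hpR α) (hqR β) x₀ y₀)
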